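/- Let $R$ be a commutative Noetherian ring with $1\neq 0$, let $\mathfrak b\subseteq\mathfrak a$ be ideals of $R$, and let $M$ be a finitely generated $R$-module. Write $H^i_{\mathfrak a}(M)=\varinjlim_t \operatorname{Ext}^i_R(R/\mathfrak a^t,M)$ for the local cohomology modules. For an integer $n\ge 0$, an $R$-module $L$ is *in dimension $<n$* if $\dim\operatorname{Supp}(L/N)<n$ for some finitely generated submodule $N\subseteq L$ (with $\dim\emptyset=-\infty$). With values in $\mathbb N_0\cup\{\infty\}$ and $\inf\emptyset=\infty$, put $$h_{\mathfrak a}^{\mathfrak b}(M)^n=\inf\{i\in\mathbb N_0:\ \mathfrak b^tH^i_{\mathfrak a}(M)\text{ is not in dimension}<n\text{ for all }t\},$$ $$f_{\mathfrak a}^{\mathfrak b}(M)=\inf\{i\in\mathbb N_0:\ \mathfrak b\not\subseteq\operatorname{Rad}(0:_RH^i_{\mathfrak a}(M))\},\qquad f_{\mathfrak a}(M)=\inf\{i\in\mathbb N_0:\ H^i_{\mathfrak a}(M)\text{ is not finitely generated}\},$$ $$f^k_{\mathfrak a}(M)=\inf\{f_{\mathfrak aR_{\mathfrak p}}(M_{\mathfrak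 p}):\ \mathfrak p\in\operatorname{Supp}(M/\mathfrak aM),\ \dim R/\mathfrak p\ge k\},$$ the invariants of $M_{\mathfrak p}$ being taken over $R_{\mathfrak p}$. If $\mathfrak aM\ne M$, let $\operatorname{grade}_M\mathfrak a$ be the supremum of the lengths of the $M$-regular sequences contained in $\mathfrak a$. (i) For every integer $n\ge 0$ and every $r\in\{1,\ f_{\mathfrak a}(M),\ f^1_{\mathfrak a}(M),\ f^2_{\mathfrak a}(M)\}$, $$h_{\mathfrak aR_{\mathfrak p}}^{\mathfrak bR_{\mathfrak p}}(M_{\mathfrak p})^n>r\ \text{ for all }\mathfrak p\in\operatorname{Spec}R\iff h_{\mathfrak a}^{\mathfrak b}(M)^n>r$$ (if $r=\infty$, both sides are false). (ii) If $\mathfrak aM\neq M$, then the same equivalence holds for every $n\ge 0$ with $r=\operatorname{grade}_M\mathfrak a$. In particular, $$f_{\mathfrak aR_{\mathfrak p}}^{\mathfrak bR_{\mathfrak p}}(M_{\mathfrak p})>\operatorname{grade}_M\mathfrak a\ \text{ for all }\mathfrak p\in\operatorname{Spec}R\iff f_{\mathfrak a}^{\mathfrak b}(M)>\operatorname{grade}_M\mathfrak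 a .$$ -/

import Mathlib

universe u v

noncomputable section

namespace LocalGlobal

/-- `M` is in dimension `< n`: some finitely generated submodule `N` of `M` satisfies
`dim Supp (M / N) < n` (the empty support has dimension `⊥`). -/
def InDimensionLT (R : Type u) [CommRing R] (M : Type v) [AddCommGroup M] [Module R M]
    (n : ℕ) : Prop :=
  ∃ N : Submodule R M, N.FG ∧ Module.supportDim R (M ⧸ N) < (n : WithBot ℕ∞)

section

variable {R : Type u} [CommRing R]

/-- The local cohomology module `H^i_a(M) = colim_t Ext^i_R(R / a ^ t, M)`. -/
abbrev H (a : Ideal R) (i : ℕ) (M : Type u) [AddCommGroup M] [Module R M] : Type u :=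
  (localCohomology a i).obj (ModuleCat.of R M)

/-- The invariant `h_a^b(M)^n`: the least `i` such that `b ^ t H^i_a(M)` is in dimension `< n`
for no `t`, and `⊤` if there is no such `i`. -/
def hDim (a b : Ideal R) (M : Type u) [AddCommGroup M] [Module R M] (n : ℕ) : ℕ∞ :=
  ⨅ (i : ℕ) (_ : ∀ t : ℕ, ¬ InDimensionLT R ↥(b ^ t • (⊤ : Submodule R (H a i M))) n), (i : ℕ∞)

/-- The `b`-finiteness dimension `f_a^b(M)` of `M` relative to `a`: the least `i` such that `b`
is not contained in the radical of the annihilator of `H^i_a(M)`. -/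
def bFinitenessDim (a b : Ideal R) (M : Type u) [AddCommGroup M] [Module R M] : ℕ∞ :=
  ⨅ (i : ℕ) (_ : ¬ b ≤ (Module.annihilator R (H a i M)).radical), (i : ℕ∞)

/-- The finiteness dimension `f_a(M)` of `M` relative to `a`. -/
def finitenessDim (a : Ideal R) (M : Type u) [AddCommGroup M] [Module R M] : ℕ∞ :=
  ⨅ (i : ℕ) (_ : ¬ Module.Finite R (H a i M)), (i : ℕ∞)

/-- The extension `a R_p` of `a` to the localization at `p`. -/
abbrev locIdeal (p : PrimeSpectrum R) (a : Ideal R) : Ideal (Localization.AtPrime p.asIdeal) :=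
  a.map (algebraMap R (Localization.AtPrime p.asIdeal))

/-- The localization `M_p`, a module over `R_p`. -/
abbrev locModule (p : PrimeSpectrum R) (M : Type u) [AddCommGroup M] [Module R M] : Type u :=
  LocalizedModule p.asIdeal.primeCompl M

/-- The `n`-th finiteness dimension `f^n_a(M)`: the infimum of `f_{a R_p}(M_p)` over the primes
`p` in the support of `M / a M` with `dim R / p ≥ n`. -/
def nthFinitenessDim (n : ℕ) (a : Ideal R) (M : Type u) [AddCommGroup M] [Module R M] : ℕ∞ :=
  ⨅ (p : PrimeSpectrum R)
    (_ : p ∈ Module.support R (M ⧸ (a • (⊤ : Submodule R M))) ∧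
      (n : WithBot ℕ∞) ≤ ringKrullDim (R ⧸ p.asIdeal)),
    finitenessDim (locIdeal p a) (locModule p M)

/-- `grade_M a`: the supremum of the lengths of the `M`-regular sequences in `a`. -/
def gradeOn (a : Ideal R) (M : Type u) [AddCommGroup M] [Module R M] : ℕ∞ :=
  ⨆ (rs : List R) (_ : (∀ x ∈ rs, x ∈ a) ∧ RingTheory.Sequence.IsRegular M rs),
    (rs.length : ℕ∞)

end

end LocalGlobal

end

open LocalGlobal

/-! Since `H^i_a(M)` is `a`-torsion and `b ≤ a`, a finitely generated submodule of `b ^ t H^i_a(M)`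
is killed by a power of `b`. So some `b ^ t H^i_a(M)` is in dimension `< n` iff some `b ^ t
H^i_a(M)` has support of dimension `< n`, that is, iff for some `t` no chain of primes of length `n`
starts in that support (`exists_inDimensionLT_iff`, `exists_supportDim_lt_iff`). Local cohomology
and supports localize, and a chain survives localization at its last prime. Hence the local
hypothesis removes each relevant prime from the support of `b ^ t H^i_a(M)`, for a `t` depending on
the prime. Every prime of the support contains an associated prime, and the associated primes of `b
^ t H^i_a(M)` are among those of `H^i_a(M)`. If these are finitely many, one `t` serves all
(`exists_supportDim_lt_local_iff`).

It remains to show that `H^i_a(M)` has finitely many associated primes for `i ≤ f^2_a(M)`; this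
covers every `r` in question, because `1` and the grade are at most `f_a(M)`, while `f_a(M)` and
`f^1_a(M)` are at most `f^2_a(M)`. Finiteness of `Hom(R ⧸ a, H^i_a(M))` is enough, and it follows
once the lower `H^j_a(M)` are cofinite, i.e. have all `Ext^k(R ⧸ a, -)` finitely generated
(`IsExactClosed.ext_localCohomology_succ`). Cofiniteness below `f^2_a(M)` is proved by induction:
modulo the finitely generated submodule killed by a large power of `a`, `H^j_a(M)` has support of
dimension at most one. For such torsion modules, finiteness of `Hom` and `Ext¹` implies cofiniteness
(`finite_extQuot_of_support`). The statement for `f_a^b` is the case `n = 0`. -/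

namespace LocalGlobal

open CategoryTheory Limits Abelian Opposite

variable {R : Type u} [CommRing R]

/-! ### Comparison of the derived functor `Ext` with `Abelian.Ext`, naturally in the first variable.
-/

/-- The map of cochain complexes `Hom(Q, Y) ⟶ Hom(P, Y)` induced by `P ⟶ Q`. -/
noncomputable def yonedaMap {P Q : ChainComplex (ModuleCat.{u} R) ℕ} (φ : P ⟶ Q)
    (Y : ModuleCat.{u} R) :
    Q.linearYonedaObj R Y ⟶ P.linearYonedaObj R Y :=
  (HomologicalComplex.unopFunctor _ _).map
    (((((linearYoneda R (ModuleCat.{u} R)).obj Y).rightOp.mapHomologicalComplex _).map φ).op)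

lemma inv_comm_of_hom_comm {D : Type*} [Category* D] {A B A' B' : D} (e : A ≅ B) (e' : A' ≅ B')
    (f : A ⟶ A') (g : B ⟶ B') (h : f ≫ e'.hom = e.hom ≫ g) : g ≫ e'.inv = e.inv ≫ f := by
  rw [Iso.comp_inv_eq, Category.assoc, h, Iso.inv_hom_id_assoc]

/-- `Ext` is obtained by unopping the left derived functors of `Hom(-, Y)` with values in the
opposite category. Naturality thus combines that of `isoLeftDerivedObj` with that of the comparison
between homology and homology of the opposite complex. -/
lemma isoExt_hom_naturality {X X' : ModuleCat.{u} R} (g : X' ⟶ X) (P : ProjectiveResolution X)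
    (P' : ProjectiveResolution X') (φ : ProjectiveResolution.Hom P' P g)
    (Y : ModuleCat.{u} R) (n : ℕ) :
    ((Ext R (ModuleCat.{u} R) n).map g.op).app Y ≫ (P'.isoExt n Y).hom =
      (P.isoExt n Y).hom ≫ HomologicalComplex.homologyMap (yonedaMap φ.hom Y) n := by
  let F := ((linearYoneda R (ModuleCat.{u} R)).obj Y).rightOp
  have h1 := congrArg Quiver.Hom.unop (ProjectiveResolution.isoLeftDerivedObj_inv_naturality g P' P
    φ.hom φ.hom_f_zero_comp_π_f_zero F n)
  have h2 := congrArg Quiver.Hom.unop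
    (HomologicalComplex.homologyOp_hom_naturality (yonedaMap φ.hom Y) n)
  have h3 : (((F.mapHomologicalComplex (ComplexShape.down ℕ) ⋙
      HomologicalComplex.homologyFunctor _ _ n).map φ.hom).unop) ≫
        (HomologicalComplex.homologyUnop
          ((F.mapHomologicalComplex (ComplexShape.down ℕ)).obj P'.complex) n).inv =
      (HomologicalComplex.homologyUnop
          ((F.mapHomologicalComplex (ComplexShape.down ℕ)).obj P.complex) n).inv ≫
        HomologicalComplex.homologyMap (yonedaMap φ.hom Y) n :=
    inv_comm_of_hom_comm (HomologicalComplex.homologyUnop _ n)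
      (HomologicalComplex.homologyUnop _ n) _ _ h2.symm
  exact (congrArg (· ≫ (HomologicalComplex.homologyUnop _ n).inv) h1).trans
    ((Category.assoc _ _ _).trans ((congrArg (_ ≫ ·) h3).trans (Category.assoc _ _ _).symm))

/-- In degree zero there are no coboundaries: the resolution, as a cochain complex, vanishes in
degree `1`. -/
lemma extMk_eq_zero_iff_zero {X Y : ModuleCat.{u} R} (P : ProjectiveResolution X)
    (f : P.complex.X 0 ⟶ Y) (hf : P.complex.d 1 0 ≫ f = 0) : P.extMk f 1 rfl hf = 0 ↔ f = 0 := by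
  refine ⟨fun h => ?_, fun h => by subst h; simp⟩
  rw [← P.extEquivCohomologyClass.apply_eq_iff_eq,
    ProjectiveResolution.extEquivCohomologyClass_extMk,
    ProjectiveResolution.extEquivCohomologyClass_zero,
    CochainComplex.HomComplex.CohomologyClass.mk_eq_zero_iff] at h
  rw [CochainComplex.HomComplex.Cocycle.toSingleMk_mem_coboundaries_iff _ _ _ _ _ 1 (by simp)] at h
  obtain ⟨g, hg⟩ := h
  have : g = 0 := (CochainComplex.isZero_of_isStrictlyLE P.cochainComplex 0 1).eq_of_src _ _
  rw [this, comp_zero] at hg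
  simpa using hg.symm

/-- The morphism underlying a cocycle of `Hom(P, Y)`. -/
noncomputable def cocycle {X Y : ModuleCat.{u} R} (P : ProjectiveResolution X) (n : ℕ)
    (c : (P.complex.linearYonedaObj R Y).cycles n) : P.complex.X n ⟶ Y :=
  (P.complex.linearYonedaObj R Y).iCycles n c

lemma d_cocycle {X Y : ModuleCat.{u} R} (P : ProjectiveResolution X) (n : ℕ)
    (c : (P.complex.linearYonedaObj R Y).cycles n) : P.complex.d (n + 1) n ≫ cocycle P n c = 0 :=
  congr($((P.complex.linearYonedaObj R Y).iCycles_d n (n + 1)) c)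

lemma smul_extMk {X Y : ModuleCat.{u} R} (P : ProjectiveResolution X) (n : ℕ)
    (r : R) (f : P.complex.X n ⟶ Y)
    (hf : P.complex.d (n+1) n ≫ f = 0) :
    P.extMk (r • f) (n+1) rfl (by simp [hf]) = r • P.extMk f (n+1) rfl hf := by
  have := P.extMk_comp_mk₀ f (n+1) rfl hf (r • 𝟙 Y)
  simp only [Linear.comp_smul, Category.comp_id] at this
  rw [← this, Ext.mk₀_smul]
  simp

/-- The map sending a cocycle of `Hom(P, Y)` to its class in `Ext^n(X, Y)`. -/
noncomputable def cyclesToExt {X : ModuleCat.{u} R} (P : ProjectiveResolution X)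
    (Y : ModuleCat.{u} R) (n : ℕ) :
    (P.complex.linearYonedaObj R Y).cycles n ⟶ ModuleCat.of R (Abelian.Ext X Y n) :=
  ModuleCat.ofHom
    { toFun := fun c => P.extMk (cocycle P n c) (n + 1) rfl (d_cocycle P n c)
      map_add' := fun c c' => by
        rw [P.add_extMk]
        congr 1
        exact map_add _ c c'
      map_smul' := fun r c => by
        rw [RingHom.id_apply, ← smul_extMk]
        congr 1
        exact map_smul ((P.complex.linearYonedaObj R Y).iCycles n).hom r c }

lemma exists_cocycle_eq {X Y : ModuleCat.{u} R} (P : ProjectiveResolution X) (n : ℕ)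
    (f : P.complex.X n ⟶ Y) (hf : P.complex.d (n + 1) n ≫ f = 0) :
    ∃ c, cocycle P n c = f := by
  have h := ShortComplex.exact_of_f_is_kernel
    (ShortComplex.mk _ _ ((P.complex.linearYonedaObj R Y).iCycles_d n (n + 1)))
    ((P.complex.linearYonedaObj R Y).cyclesIsKernel n (n + 1) (by simp))
  rw [ShortComplex.moduleCat_exact_iff] at h
  exact h f hf

lemma cyclesToExt_surjective {X : ModuleCat.{u} R} (P : ProjectiveResolution X)
    (Y : ModuleCat.{u} R) (n : ℕ) : Function.Surjective (cyclesToExt P Y n) := by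
  intro α
  obtain ⟨f, hf, rfl⟩ := P.extMk_surjective α (n + 1) rfl
  obtain ⟨c, rfl⟩ := exists_cocycle_eq P n f hf
  exact ⟨c, rfl⟩

lemma cocycle_injective {X Y : ModuleCat.{u} R} (P : ProjectiveResolution X) (n : ℕ) :
    Function.Injective (cocycle (Y := Y) P n) :=
  (ModuleCat.mono_iff_injective ((P.complex.linearYonedaObj R Y).iCycles n)).1 inferInstance

lemma cocycle_toCycles {X Y : ModuleCat.{u} R} (P : ProjectiveResolution X) (n : ℕ)
    (g : P.complex.X n ⟶ Y) :
    cocycle P (n + 1) ((P.complex.linearYonedaObj R Y).toCycles n (n + 1) g) =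
      P.complex.d (n + 1) n ≫ g :=
  congr($((P.complex.linearYonedaObj R Y).toCycles_i n (n + 1)) g)

lemma cyclesToExt_succ_eq_zero_iff {X : ModuleCat.{u} R} (P : ProjectiveResolution X)
    (Y : ModuleCat.{u} R) (n : ℕ) (c : (P.complex.linearYonedaObj R Y).cycles (n + 1)) :
    cyclesToExt P Y (n + 1) c = 0 ↔
      ∃ g, (P.complex.linearYonedaObj R Y).toCycles n (n + 1) g = c := by
  refine (P.extMk_eq_zero_iff _ _ rfl (d_cocycle P (n + 1) c) n rfl).trans ?_
  refine exists_congr fun g => ?_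
  rw [← cocycle_toCycles, (cocycle_injective P (n + 1)).eq_iff]

/-- In positive degree both objects are cokernels of `toCycles`. In degree zero nothing is divided
out, and the cycles map isomorphically to both. -/
lemma exists_homologyIso {X : ModuleCat.{u} R} (P : ProjectiveResolution X)
    (Y : ModuleCat.{u} R) (n : ℕ) :
    ∃ e : (P.complex.linearYonedaObj R Y).homology n ≅ ModuleCat.of R (Abelian.Ext X Y n),
      (P.complex.linearYonedaObj R Y).homologyπ n ≫ e.hom = cyclesToExt P Y n := by
  have hepi : Epi (cyclesToExt P Y n) :=
    (ModuleCat.epi_iff_surjective _).2 (cyclesToExt_surjective P Y n)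
  cases n with
  | zero =>
    have hmono : Mono (cyclesToExt P Y 0) := by
      rw [ModuleCat.mono_iff_injective, injective_iff_map_eq_zero']
      intro c
      refine (extMk_eq_zero_iff_zero P _ (d_cocycle P 0 c)).trans ?_
      exact map_eq_zero_iff ((P.complex.linearYonedaObj R Y).iCycles 0).hom
        (cocycle_injective P 0)
    have := isIso_of_mono_of_epi (cyclesToExt P Y 0)
    have : IsIso ((P.complex.linearYonedaObj R Y).homologyπ 0) := inferInstance
    exact ⟨(asIso ((P.complex.linearYonedaObj R Y).homologyπ 0)).symm ≪≫
      asIso (cyclesToExt P Y 0), by simp⟩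
  | succ n =>
    have w : (P.complex.linearYonedaObj R Y).toCycles n (n + 1) ≫ cyclesToExt P Y (n + 1) = 0 := by
      ext g
      exact (cyclesToExt_succ_eq_zero_iff P Y n _).2 ⟨g, rfl⟩
    have hex : (ShortComplex.mk _ _ w).Exact := by
      rw [ShortComplex.moduleCat_exact_iff]
      intro c hc
      exact (cyclesToExt_succ_eq_zero_iff P Y n c).1 hc
    refine ⟨((P.complex.linearYonedaObj R Y).homologyIsCokernel n (n + 1)
      (by simp)).coconePointUniqueUpToIso hex.gIsCokernel, ?_⟩
    exact IsColimit.comp_coconePointUniqueUpToIso_hom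
      ((P.complex.linearYonedaObj R Y).homologyIsCokernel n (n + 1) (by simp))
      hex.gIsCokernel WalkingParallelPair.one

lemma extMk_congr {X Y : ModuleCat.{u} R} (P : ProjectiveResolution X) {n : ℕ}
    {f f' : P.complex.X n ⟶ Y} (h : f = f') (hf : P.complex.d (n + 1) n ≫ f = 0) :
    P.extMk f (n + 1) rfl hf = P.extMk f' (n + 1) rfl (h ▸ hf) := by
  subst h; rfl

/-- The comparison between the two constructions of `Ext`. -/
noncomputable def extIso (X Y : ModuleCat.{u} R) (n : ℕ) :
    ((_root_.Ext R (ModuleCat.{u} R) n).obj (op X)).obj Y ≅ ModuleCat.of R (Abelian.Ext X Y n) :=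
  (projectiveResolution X).isoExt n Y ≪≫ (exists_homologyIso (projectiveResolution X) Y n).choose

/-- Precomposition on `Ext` with a linear map. -/
noncomputable def extPrecomp {X X' : ModuleCat.{u} R} (g : X' ⟶ X) (Y : ModuleCat.{u} R) (n : ℕ) :
    ModuleCat.of R (Abelian.Ext X Y n) ⟶ ModuleCat.of R (Abelian.Ext X' Y n) :=
  ModuleCat.ofHom ((Abelian.Ext.mk₀ g).precompOfLinear R Y (zero_add n))

lemma extIso_naturality {X X' : ModuleCat.{u} R} (g : X' ⟶ X) (Y : ModuleCat.{u} R) (n : ℕ) :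
    ((_root_.Ext R (ModuleCat.{u} R) n).map g.op).app Y ≫ (extIso X' Y n).hom =
      (extIso X Y n).hom ≫ extPrecomp g Y n := by
  let φ : ProjectiveResolution.Hom (projectiveResolution X') (projectiveResolution X) g :=
    ⟨ProjectiveResolution.lift g _ _, ProjectiveResolution.lift_commutes_zero g _ _⟩
  have h₁ := isoExt_hom_naturality g _ _ φ Y n
  have h₂ := (exists_homologyIso (projectiveResolution X) Y n).choose_spec
  have h₃ := (exists_homologyIso (projectiveResolution X') Y n).choose_spec
  dsimp only [extIso, Iso.trans_hom]
  rw [reassoc_of% h₁, Category.assoc]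
  congr 1
  -- It suffices to compare on cocycles, where both sides send `c` to the class of `φ.hom.f n ≫ c`.
  rw [← cancel_epi (HomologicalComplex.homologyπ _ n), HomologicalComplex.homologyπ_naturality_assoc,
    h₃, reassoc_of% h₂]
  ext c
  have h₄ := ProjectiveResolution.mk₀_comp_extMk (cocycle _ n c) (n + 1) rfl (d_cocycle _ n c) φ
  have h₅ : cocycle (projectiveResolution X') n
      (HomologicalComplex.cyclesMap (yonedaMap φ.hom Y) n c) =
        φ.hom.f n ≫ cocycle (projectiveResolution X) n c :=
    congr($(HomologicalComplex.cyclesMap_i (yonedaMap φ.hom Y) n) c)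
  refine Eq.trans ?_ h₄.symm
  exact extMk_congr _ h₅ (d_cocycle _ _ _)

/-! ### Local cohomology as a colimit of `Abelian.Ext`; degree zero is the torsion submodule. -/

/-- The `a`-torsion submodule of `M`. -/
def gamma (a : Ideal R) (M : Type*) [AddCommGroup M] [Module R M] : Submodule R M where
  carrier := {m | ∃ t : ℕ, ∀ x ∈ a ^ t, x • m = 0}
  zero_mem' := ⟨0, by simp⟩
  add_mem' := by
    rintro m m' ⟨t, ht⟩ ⟨t', ht'⟩
    refine ⟨max t t', fun x hx => ?_⟩
    rw [smul_add, ht x (Ideal.pow_le_pow_right (le_max_left _ _) hx),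
      ht' x (Ideal.pow_le_pow_right (le_max_right _ _) hx), add_zero]
  smul_mem' := by
    rintro r m ⟨t, ht⟩
    exact ⟨t, fun x hx => by rw [smul_comm, ht x hx, smul_zero]⟩

lemma mem_gamma {a : Ideal R} {M : Type*} [AddCommGroup M] [Module R M] {m : M} :
    m ∈ gamma a M ↔ ∃ t : ℕ, ∀ x ∈ a ^ t, x • m = 0 := Iff.rfl

/-- The module `R ⧸ a ^ t`. -/
noncomputable abbrev quotPow (a : Ideal R) (t : ℕᵒᵖᵒᵖ) : ModuleCat.{u} R :=
  (localCohomology.ringModIdeals (localCohomology.idealPowersDiagram a)).obj (unop t)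

/-- The projections between the modules `R ⧸ a ^ t`. -/
noncomputable abbrev quotPowMap (a : Ideal R) {t s : ℕᵒᵖᵒᵖ} (w : t ⟶ s) :
    quotPow a s ⟶ quotPow a t :=
  (localCohomology.ringModIdeals (localCohomology.idealPowersDiagram a)).map w.unop

/-- The direct system of the modules `Ext^n(R ⧸ a ^ t, Y)`. -/
noncomputable def extDiagram (a : Ideal R) (Y : ModuleCat.{u} R) (n : ℕ) :
    ℕᵒᵖᵒᵖ ⥤ ModuleCat.{u} R where
  obj t := ModuleCat.of R (Abelian.Ext (quotPow a t) Y n)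
  map w := extPrecomp (quotPowMap a w) Y n
  map_id t := by
    have h : quotPowMap a (𝟙 t) = 𝟙 _ := CategoryTheory.Functor.map_id _ _
    ext α
    simp [extPrecomp, h]
  map_comp v w := by
    have h : quotPowMap a (v ≫ w) = quotPowMap a w ≫ quotPowMap a v :=
      CategoryTheory.Functor.map_comp _ _ _
    ext α
    simp [extPrecomp, h]

/-- Comparison of `extDiagram` with the diagram defining local cohomology. -/
noncomputable def diagramIso (a : Ideal R) (Y : ModuleCat.{u} R) (n : ℕ) :
    localCohomology.diagram (localCohomology.idealPowersDiagram a) n ⋙ (evaluation _ _).obj Y ≅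
      extDiagram a Y n :=
  NatIso.ofComponents (fun t => extIso (quotPow a t) Y n)
    (fun w => extIso_naturality (quotPowMap a w) Y n)

/-- Local cohomology as the colimit of `extDiagram`. -/
noncomputable def localCohomologyIso (a : Ideal R) (Y : ModuleCat.{u} R) (n : ℕ) :
    (localCohomology a n).obj Y ≅ colimit (extDiagram a Y n) :=
  have := localCohomology.hasColimitDiagram.{u, 0} (localCohomology.idealPowersDiagram a) n
  colimitObjIsoColimitCompEvaluation _ _ ≪≫ HasColimit.isoOfNatIso (diagramIso a Y n)

/-- The map `R ⧸ a ^ t ⟶ Y` sending `1` to an element killed by `a ^ t`. -/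
noncomputable def quotPowHom (a : Ideal R) (t : ℕᵒᵖᵒᵖ) (Y : ModuleCat.{u} R) (y : Y)
    (hy : ∀ x ∈ a ^ (unop (unop t)), x • y = 0) : quotPow a t ⟶ Y :=
  ModuleCat.ofHom ((a ^ (unop (unop t))).liftQ (LinearMap.toSpanSingleton R Y y) hy)

/-- The element `1` of `R ⧸ a ^ t`. -/
noncomputable def quotPowOne (a : Ideal R) (t : ℕᵒᵖᵒᵖ) : quotPow a t :=
  Submodule.Quotient.mk (1 : R)

lemma quotPow_ext {a : Ideal R} {t : ℕᵒᵖᵒᵖ} {Y : ModuleCat.{u} R} {f g : quotPow a t ⟶ Y}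
    (h : f (quotPowOne a t) = g (quotPowOne a t)) : f = g := by
  ext x
  obtain ⟨r, rfl⟩ := Submodule.Quotient.mk_surjective _ x
  have : (Submodule.Quotient.mk r : quotPow a t) = r • quotPowOne a t := by
    change _ = Submodule.Quotient.mk (r • 1)
    simp
  exact (congrArg f this).trans (((map_smul f.hom r _).trans
    ((congrArg (r • ·) h).trans (map_smul g.hom r _).symm)).trans (congrArg g this).symm)

lemma quotPowHom_one (a : Ideal R) (t : ℕᵒᵖᵒᵖ) (Y : ModuleCat.{u} R) (y : Y)
    (hy : ∀ x ∈ a ^ (unop (unop t)), x • y = 0) :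
    quotPowHom a t Y y hy (quotPowOne a t) = y :=
  one_smul R y

lemma apply_one_mem_gamma {a : Ideal R} {t : ℕᵒᵖᵒᵖ} {Y : ModuleCat.{u} R} (f : quotPow a t ⟶ Y) :
    f (quotPowOne a t) ∈ gamma a Y := by
  refine ⟨unop (unop t), fun x hx => ?_⟩
  have : x • quotPowOne a t = 0 :=
    (Submodule.Quotient.mk_eq_zero _).2 ((congrArg (· ∈ a ^ _) (mul_one x)).mpr hx)
  exact (map_smul f.hom x _).symm.trans ((congrArg f this).trans (map_zero f.hom))


/-- Evaluation at `1` from the degree zero part of the direct system to the torsion submodule. -/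
noncomputable def extZeroToGamma (a : Ideal R) (Y : ModuleCat.{u} R) (t : ℕᵒᵖᵒᵖ) :
    Abelian.Ext (quotPow a t) Y 0 →ₗ[R] gamma a Y :=
  LinearMap.codRestrict _
    ((LinearMap.applyₗ (quotPowOne a t)).comp
      (ModuleCat.homLinearEquiv.toLinearMap.comp
        (Ext.linearEquiv₀ (R := R) (X := quotPow a t) (Y := Y)).toLinearMap))
    (fun α => apply_one_mem_gamma (Ext.linearEquiv₀ (R := R) α))

lemma extZeroToGamma_mk₀ (a : Ideal R) (Y : ModuleCat.{u} R) (t : ℕᵒᵖᵒᵖ) (f : quotPow a t ⟶ Y) :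
    (extZeroToGamma a Y t (Ext.mk₀ f) : Y) = f (quotPowOne a t) := by
  change (Ext.linearEquiv₀ (R := R) (Ext.mk₀ f)) (quotPowOne a t) = f (quotPowOne a t)
  congr 1
  exact congrArg ModuleCat.Hom.hom ((Ext.linearEquiv₀ (R := R)).symm_apply_eq.1 rfl).symm

/-- The cocone from the degree zero direct system to the torsion submodule. -/
noncomputable def gammaCocone (a : Ideal R) (Y : ModuleCat.{u} R) :
    Cocone (extDiagram a Y 0) where
  pt := ModuleCat.of R (gamma a Y)
  ι :=
    { app := fun t => ModuleCat.ofHom (extZeroToGamma a Y t)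
      naturality := fun t s w => by
        ext α
        obtain ⟨f, rfl⟩ := (Ext.mk₀_bijective _ _).2 α
        refine Subtype.ext ?_
        have h : (extDiagram a Y 0).map w (Ext.mk₀ f) = Ext.mk₀ (quotPowMap a w ≫ f) := by
          change (Ext.mk₀ (quotPowMap a w)).comp (Ext.mk₀ f) (zero_add 0) = _
          simp
        change (extZeroToGamma a Y s ((extDiagram a Y 0).map w (Ext.mk₀ f)) : Y) =
          extZeroToGamma a Y t (Ext.mk₀ f)
        rw [h, extZeroToGamma_mk₀, extZeroToGamma_mk₀]
        rfl }

lemma gammaDesc_ι (a : Ideal R) (Y : ModuleCat.{u} R) (t : ℕᵒᵖᵒᵖ) (f : quotPow a t ⟶ Y) :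
    ((colimit.desc _ (gammaCocone a Y)).hom ((colimit.ι (extDiagram a Y 0) t).hom (Ext.mk₀ f)) :
      gamma a Y) = ⟨f (quotPowOne a t), apply_one_mem_gamma f⟩ := by
  refine Eq.trans (congr($(colimit.ι_desc (gammaCocone a Y) t) (Ext.mk₀ f))) ?_
  exact Subtype.ext (extZeroToGamma_mk₀ a Y t f)

/-- Allows elements of the colimit to be represented, and tested for vanishing, at a finite stage.
-/
instance : PreservesColimitsOfShape ℕᵒᵖᵒᵖ (forget (ModuleCat.{u} R)) :=
  have : PreservesFilteredColimitsOfSize.{0, 0} (forget (ModuleCat.{u} R)) :=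
    preservesFilteredColimitsOfSize_shrink.{0, u, 0, u} _
  inferInstance

lemma exists_rep_extDiagram_zero (a : Ideal R) (Y : ModuleCat.{u} R)
    (z : (colimit (extDiagram a Y 0) : ModuleCat.{u} R)) :
    ∃ (t : ℕᵒᵖᵒᵖ) (f : quotPow a t ⟶ Y), (colimit.ι (extDiagram a Y 0) t).hom (Ext.mk₀ f) = z := by
  obtain ⟨t, α, rfl⟩ := Concrete.colimit_exists_rep _ z
  obtain ⟨f, rfl⟩ := (Ext.mk₀_bijective _ _).2 α
  exact ⟨t, f, rfl⟩

lemma gammaDesc_bijective (a : Ideal R) (Y : ModuleCat.{u} R) :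
    Function.Bijective (colimit.desc _ (gammaCocone a Y)).hom := by
  constructor
  · rw [injective_iff_map_eq_zero]
    intro z hz
    obtain ⟨t, f, rfl⟩ := exists_rep_extDiagram_zero a Y z
    rw [gammaDesc_ι] at hz
    have hf : f = 0 := quotPow_ext (congrArg Subtype.val hz)
    rw [hf, Ext.mk₀_zero]
    exact map_zero _
  · rintro ⟨y, t, ht⟩
    refine ⟨(colimit.ι (extDiagram a Y 0) (op (op t))).hom
      (Ext.mk₀ (quotPowHom a (op (op t)) Y y ht)), ?_⟩
    rw [gammaDesc_ι]
    exact Subtype.ext (quotPowHom_one a (op (op t)) Y y ht)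

/-- The colimit of the degree zero direct system is the torsion submodule. -/
noncomputable def gammaEquiv (a : Ideal R) (Y : ModuleCat.{u} R) :
    (colimit (extDiagram a Y 0) : ModuleCat.{u} R) ≃ₗ[R] gamma a Y :=
  LinearEquiv.ofBijective (colimit.desc _ (gammaCocone a Y)).hom (gammaDesc_bijective a Y)

/-! ### Dimension shifting along an embedding into an injective module. -/

/-- The connecting homomorphisms between the direct systems. -/
noncomputable def connecting (a : Ideal R) {S : ShortComplex (ModuleCat.{u} R)} (hS : S.ShortExact)
    (n : ℕ) : extDiagram a S.X₃ n ⟶ extDiagram a S.X₁ (n + 1) where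
  app t := ModuleCat.ofHom (hS.extClass.postcompOfLinear R (quotPow a t) rfl)
  naturality t s w := by
    ext α
    change ((Ext.mk₀ (quotPowMap a w)).comp α (zero_add n)).comp hS.extClass (rfl : n + 1 = n + 1) =
      (Ext.mk₀ (quotPowMap a w)).comp (α.comp hS.extClass (rfl : n + 1 = n + 1)) (zero_add (n + 1))
    exact Ext.comp_assoc _ _ _ _ _ (by lia)

lemma connecting_surjective (a : Ideal R) {S : ShortComplex (ModuleCat.{u} R)} (hS : S.ShortExact)
    [Injective S.X₂] (n : ℕ) (t : ℕᵒᵖᵒᵖ) : Function.Surjective ((connecting a hS n).app t).hom :=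
  fun x => Ext.covariant_sequence_exact₁ _ hS x (Ext.eq_zero_of_injective _) rfl

lemma connecting_succ_isIso (a : Ideal R) {S : ShortComplex (ModuleCat.{u} R)} (hS : S.ShortExact)
    [Injective S.X₂] (n : ℕ) : IsIso (connecting a hS (n + 1)) := by
  have (t : ℕᵒᵖᵒᵖ) : IsIso ((connecting a hS (n + 1)).app t) := by
    rw [ConcreteCategory.isIso_iff_bijective]
    refine ⟨?_, connecting_surjective a hS _ t⟩
    refine (injective_iff_map_eq_zero ((connecting a hS (n + 1)).app t).hom).2 fun x hx => ?_
    obtain ⟨y, rfl⟩ := Ext.covariant_sequence_exact₃ _ hS x rfl hx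
    rw [Ext.eq_zero_of_injective y, Ext.zero_comp]
    rfl
  exact NatIso.isIso_of_isIso_app _

/-- The map from the torsion submodule of `X₃` to the first local cohomology of `X₁`. -/
noncomputable def gammaToColimit (a : Ideal R) {S : ShortComplex (ModuleCat.{u} R)}
    (hS : S.ShortExact) :
    gamma a S.X₃ →ₗ[R] (colimit (extDiagram a S.X₁ 1) : ModuleCat.{u} R) :=
  (colimMap (connecting a hS 0)).hom.comp (gammaEquiv a S.X₃).symm.toLinearMap

lemma gammaToColimit_apply_one (a : Ideal R) {S : ShortComplex (ModuleCat.{u} R)}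
    (hS : S.ShortExact) {t : ℕᵒᵖᵒᵖ} (f : quotPow a t ⟶ S.X₃) :
    gammaToColimit a hS ⟨f (quotPowOne a t), apply_one_mem_gamma f⟩ =
      (colimit.ι (extDiagram a S.X₁ 1) t).hom ((Ext.mk₀ f).comp hS.extClass (zero_add 1)) := by
  have h : (gammaEquiv a S.X₃).symm ⟨f (quotPowOne a t), apply_one_mem_gamma f⟩ =
      (colimit.ι (extDiagram a S.X₃ 0) t).hom (Ext.mk₀ f) := by
    rw [LinearEquiv.symm_apply_eq]
    exact (gammaDesc_ι a S.X₃ t f).symm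
  refine (congrArg (colimMap (connecting a hS 0)).hom h).trans ?_
  exact congr($(ι_colimMap (connecting a hS 0) t) (Ext.mk₀ f))

lemma gammaToColimit_surjective (a : Ideal R) {S : ShortComplex (ModuleCat.{u} R)}
    (hS : S.ShortExact) [Injective S.X₂] : Function.Surjective (gammaToColimit a hS) := by
  intro z
  obtain ⟨t, α, rfl⟩ := Concrete.colimit_exists_rep _ z
  obtain ⟨β, rfl⟩ := connecting_surjective a hS 0 t α
  obtain ⟨f, rfl⟩ := (Ext.mk₀_bijective _ _).2 β
  exact ⟨_, gammaToColimit_apply_one a hS f⟩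

/-- A class vanishing in the colimit vanishes at a later stage `s`. There the connecting class of `R
⧸ a ^ s ⟶ X₃` is zero, so this map lifts to `X₂`, and the value of the lift at `1` is the torsion
element sought. -/
lemma gammaToColimit_eq_zero_iff (a : Ideal R) {S : ShortComplex (ModuleCat.{u} R)}
    (hS : S.ShortExact) (z : gamma a S.X₃) :
    gammaToColimit a hS z = 0 ↔ ∃ e ∈ gamma a S.X₂, S.g e = z := by
  constructor
  · obtain ⟨z, t, ht⟩ := z
    intro h
    have hf := quotPowHom_one a (op (op t)) S.X₃ z ht
    generalize quotPowHom a (op (op t)) S.X₃ z ht = f at hf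
    subst hf
    rw [gammaToColimit_apply_one] at h
    obtain ⟨s, w, hw⟩ := Concrete.colimit_rep_eq_zero _ _ _ _ h
    have h₁ : ((Ext.mk₀ (quotPowMap a w ≫ f)).comp hS.extClass (zero_add 1)) = 0 := by
      refine Eq.trans ?_ hw
      change _ = (Ext.mk₀ (quotPowMap a w)).comp ((Ext.mk₀ f).comp hS.extClass (zero_add 1)) (zero_add 1)
      simp
    obtain ⟨β, hβ⟩ := Ext.covariant_sequence_exact₃ _ hS _ _ h₁
    obtain ⟨k, rfl⟩ := (Ext.mk₀_bijective _ _).2 β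
    rw [Ext.mk₀_comp_mk₀] at hβ
    have h₂ := (Ext.mk₀_bijective _ _).1 hβ
    refine ⟨k (quotPowOne a s), apply_one_mem_gamma k, ?_⟩
    exact congr($h₂ (quotPowOne a s))
  · rintro ⟨e, ⟨t, ht⟩, he⟩
    have hf := quotPowHom_one a (op (op t)) S.X₂ e ht
    set f := quotPowHom a (op (op t)) S.X₂ e ht
    have hz : z = ⟨(f ≫ S.g) (quotPowOne a (op (op t))), apply_one_mem_gamma _⟩ :=
      Subtype.ext (he.symm.trans (congrArg S.g hf.symm))
    rw [hz, gammaToColimit_apply_one, ← Ext.mk₀_comp_mk₀, Ext.comp_assoc_of_second_deg_zero,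
      hS.comp_extClass, Ext.comp_zero]
    exact map_zero _

section Modules

variable {M E C : Type u} [AddCommGroup M] [Module R M] [AddCommGroup E] [Module R E]
  [AddCommGroup C] [Module R C]

/-- `H^0_a(M)` is the torsion submodule. -/
noncomputable def zeroEquivGamma (a : Ideal R) (M : Type u) [AddCommGroup M] [Module R M] :
    H a 0 M ≃ₗ[R] gamma a M :=
  (localCohomologyIso a (ModuleCat.of R M) 0).toLinearEquiv.trans (gammaEquiv a (ModuleCat.of R M))

lemma shortExact_of_linearMap {f : M →ₗ[R] E} {g : E →ₗ[R] C} (hf : Function.Injective f)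
    (hfg : Function.Exact f g) (hg : Function.Surjective g) :
    (ShortComplex.moduleCatMk f g hfg.linearMap_comp_eq_zero).ShortExact where
  exact := (ShortComplex.ShortExact.moduleCat_exact_iff_function_exact _).2 hfg
  mono_f := (ModuleCat.mono_iff_injective _).2 hf
  epi_g := (ModuleCat.epi_iff_surjective _).2 hg

/-- `H^1_a(M)` is the cokernel of `Γ(E) → Γ(C)`. Giving it as a surjection with prescribed kernel
makes it directly comparable after localization. -/
theorem exists_gamma_surjection_one (a : Ideal R) [Module.Injective R E] {f : M →ₗ[R] E}
    {g : E →ₗ[R] C} (hf : Function.Injective f) (hfg : Function.Exact f g)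
    (hg : Function.Surjective g) :
    ∃ φ : gamma a C →ₗ[R] H a 1 M, Function.Surjective φ ∧
      ∀ z, φ z = 0 ↔ ∃ e ∈ gamma a E, g e = z := by
  have : Injective (ModuleCat.of R E) := Module.injective_object_of_injective_module R E
  have hS := shortExact_of_linearMap hf hfg hg
  have : Injective (ShortComplex.moduleCatMk f g hfg.linearMap_comp_eq_zero).X₂ := this
  let e := (localCohomologyIso a (ModuleCat.of R M) 1).symm.toLinearEquiv
  refine ⟨e.toLinearMap.comp (gammaToColimit a hS),
    e.surjective.comp (gammaToColimit_surjective a hS), fun z => ?_⟩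
  exact Iff.trans e.map_eq_zero_iff (gammaToColimit_eq_zero_iff a hS z)

/-- In positive degrees `Ext(R ⧸ a ^ t, E)` vanishes, so the connecting maps are isomorphisms at
every stage. -/
theorem nonempty_shift_equiv (a : Ideal R) [Module.Injective R E] {f : M →ₗ[R] E}
    {g : E →ₗ[R] C} (hf : Function.Injective f) (hfg : Function.Exact f g)
    (hg : Function.Surjective g) (i : ℕ) : Nonempty (H a (i + 2) M ≃ₗ[R] H a (i + 1) C) := by
  have : Injective (ModuleCat.of R E) := Module.injective_object_of_injective_module R E
  have hS := shortExact_of_linearMap hf hfg hg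
  have : Injective (ShortComplex.moduleCatMk f g hfg.linearMap_comp_eq_zero).X₂ := this
  have := connecting_succ_isIso a hS i
  exact ⟨((localCohomologyIso a (ModuleCat.of R M) (i + 2)) ≪≫
    (HasColimit.isoOfNatIso (asIso (connecting a hS (i + 1)))).symm ≪≫
    (localCohomologyIso a (ModuleCat.of R C) (i + 1)).symm).toLinearEquiv⟩

end Modules

/-! ### Torsion of local cohomology and injectivity of `Γ(E)`. -/

theorem exists_injective_embedding (R : Type u) [CommRing R] (M : Type u) [AddCommGroup M] [Module R M] :
    ∃ (E : ModuleCat.{u} R) (f : M →ₗ[R] E), Module.Injective R E ∧ Function.Injective f := by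
  refine ⟨Injective.under (ModuleCat.of R M), (Injective.ι (ModuleCat.of R M)).hom, ?_, ?_⟩
  · have h : Injective (Injective.under (ModuleCat.of R M)) := Injective.injective_under _
    exact (Module.injective_iff_injective_object R _).2 h
  · exact (ModuleCat.mono_iff_injective _).1 (Injective.ι_mono _)

lemma exact_mkQ_range {M E : Type*} [AddCommGroup M] [Module R M] [AddCommGroup E] [Module R E]
    (f : M →ₗ[R] E) : Function.Exact f (LinearMap.range f).mkQ :=
  LinearMap.exact_iff.2 (by simp)

/-- Dimension shifting reduces to degrees `0` and `1`, where the module is isomorphic to, or a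
quotient of, a torsion submodule. -/
theorem mem_gamma_localCohomology (a : Ideal R) (i : ℕ) (M : Type u) [AddCommGroup M] [Module R M]
    (z : H a i M) : z ∈ gamma a (H a i M) := by
  rcases i with _ | i
  · obtain ⟨t, ht⟩ := (zeroEquivGamma a M z).2
    refine ⟨t, fun x hx => (zeroEquivGamma a M).injective ?_⟩
    rw [map_smul, map_zero]
    exact Subtype.ext (ht x hx)
  induction i generalizing M with
  | zero =>
    obtain ⟨E, f, _, hf⟩ := exists_injective_embedding R M
    obtain ⟨φ, hφ, -⟩ := exists_gamma_surjection_one a hf (exact_mkQ_range f)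
      (Submodule.mkQ_surjective _)
    obtain ⟨⟨c, t, ht⟩, rfl⟩ := hφ z
    refine ⟨t, fun x hx => ?_⟩
    rw [← map_smul]
    exact (congrArg φ (Subtype.ext (ht x hx))).trans (map_zero φ)
  | succ i ih =>
    obtain ⟨E, f, _, hf⟩ := exists_injective_embedding R M
    obtain ⟨e⟩ := nonempty_shift_equiv a hf (exact_mkQ_range f) (Submodule.mkQ_surjective _) i
    obtain ⟨t, ht⟩ := ih _ (e z)
    refine ⟨t, fun x hx => e.injective ?_⟩
    rw [map_smul, map_zero, ht x hx]

lemma exists_pow_smul_eq_zero_of_fg {a : Ideal R} {M : Type*} [AddCommGroup M] [Module R M]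
    (N : Submodule R M) (hN : N.FG) (h : N ≤ gamma a M) :
    ∃ t : ℕ, ∀ x ∈ a ^ t, ∀ m ∈ N, x • m = 0 := by
  induction N, hN using Submodule.fg_induction with
  | singleton m =>
    obtain ⟨t, ht⟩ := h (Submodule.mem_span_singleton_self m)
    refine ⟨t, fun x hx m' hm' => ?_⟩
    obtain ⟨r, rfl⟩ := Submodule.mem_span_singleton.1 hm'
    rw [smul_comm, ht x hx, smul_zero]
  | sup N₁ N₂ _ _ h₁ h₂ =>
    obtain ⟨t₁, ht₁⟩ := h₁ (le_sup_left.trans h)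
    obtain ⟨t₂, ht₂⟩ := h₂ (le_sup_right.trans h)
    refine ⟨max t₁ t₂, fun x hx m hm => ?_⟩
    obtain ⟨m₁, hm₁, m₂, hm₂, rfl⟩ := Submodule.mem_sup.1 hm
    rw [smul_add, ht₁ x (Ideal.pow_le_pow_right (le_max_left _ _) hx) _ hm₁,
      ht₂ x (Ideal.pow_le_pow_right (le_max_right _ _) hx) _ hm₂, add_zero]

/-- Over a noetherian ring the torsion submodule of an injective module is injective. -/
theorem injective_gamma [IsNoetherianRing R] (a : Ideal R) (E : Type u) [AddCommGroup E]
    [Module R E] [Module.Injective R E] : Module.Injective R (gamma a E) := by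
  refine Module.Baer.injective fun I g => ?_
  obtain ⟨t, ht⟩ := exists_pow_smul_eq_zero_of_fg (a := a) (LinearMap.range ((gamma a E).subtype.comp g))
    (Module.Finite.iff_fg.1 inferInstance) (by rintro _ ⟨y, rfl⟩; exact (g y).2)
  -- Artin–Rees: `a ^ (k + t) ∩ I ⊆ a ^ t I`, and `g` kills the latter. So `g` factors through the
  -- image of `I` in `R ⧸ a ^ (k + t)`; an extension of it to this quotient takes only torsion
  -- values.
  obtain ⟨k, hk⟩ := a.exists_pow_inf_eq_pow_smul (M := R) I
  have hmem : ∀ y ∈ a ^ t • (I : Submodule R R), ∃ hy : y ∈ I, g ⟨y, hy⟩ = 0 := by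
    intro y hy
    refine Submodule.smul_induction_on hy (fun x hx y hy => ?_) (fun y₁ y₂ h₁ h₂ => ?_)
    · refine ⟨I.mul_mem_left x hy, ?_⟩
      have : g (x • ⟨y, hy⟩) = 0 := by
        rw [map_smul]
        exact Subtype.ext (ht x hx _ ⟨⟨y, hy⟩, rfl⟩)
      exact this
    · obtain ⟨hy₁, h₁⟩ := h₁
      obtain ⟨hy₂, h₂⟩ := h₂
      refine ⟨I.add_mem hy₁ hy₂, ?_⟩
      have : g (⟨y₁, hy₁⟩ + ⟨y₂, hy₂⟩) = 0 := by rw [map_add, h₁, h₂, add_zero]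
      exact this
  have hker : ∀ y : I, (y : R) ∈ a ^ (k + t) → g y = 0 := by
    intro y hy
    have h₁ : (y : R) ∈ a ^ (k + t) • (⊤ : Submodule R R) ⊓ I :=
      ⟨by simpa using hy, y.2⟩
    rw [hk _ (Nat.le_add_right _ _), Nat.add_sub_cancel_left] at h₁
    exact (hmem y (Submodule.smul_mono le_rfl inf_le_right h₁)).2
  let h : I →ₗ[R] R ⧸ a ^ (k + t) := (Submodule.mkQ (a ^ (k + t))).comp I.subtype
  have hh : LinearMap.ker h ≤ LinearMap.ker ((gamma a E).subtype.comp g) := by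
    intro y hy
    have : (y : R) ∈ a ^ (k + t) := (Submodule.Quotient.mk_eq_zero _).1 hy
    simp [hker y this]
  obtain ⟨G, hG⟩ := Module.Injective.extension_property R E _ _ ((LinearMap.ker h).liftQ h le_rfl)
    (LinearMap.ker_eq_bot.1 (Submodule.ker_liftQ_eq_bot _ _ _ le_rfl))
    ((LinearMap.ker h).liftQ _ hh)
  refine ⟨LinearMap.codRestrict _ (G.comp (Submodule.mkQ (a ^ (k + t)))) fun r => ?_, ?_⟩
  · refine ⟨k + t, fun x hx => ?_⟩
    rw [← map_smul]
    have : x • r ∈ a ^ (k + t) := Ideal.mul_mem_right _ _ hx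
    exact (congrArg G ((Submodule.Quotient.mk_eq_zero _).2 this)).trans (map_zero G)
  · intro x hx
    exact Subtype.ext (LinearMap.congr_fun hG (Submodule.Quotient.mk ⟨x, hx⟩))

/-! ### Local cohomology commutes with localization. -/

section Localization

variable (S : Submonoid R)

lemma smul_mk_eq_zero_iff {M : Type*} [AddCommGroup M] [Module R M] (x : R) (m : M) (s : S) :
    x • LocalizedModule.mk m s = 0 ↔ ∃ u ∈ S, u • x • m = 0 := by
  rw [LocalizedModule.smul'_mk, ← LocalizedModule.zero_mk 1, LocalizedModule.mk_eq]
  simp [Submonoid.smul_def]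

lemma mk_eq_zero_iff' {M : Type*} [AddCommGroup M] [Module R M] (m : M) (s : S) :
    LocalizedModule.mk m s = 0 ↔ ∃ u ∈ S, u • m = 0 := by
  simpa using smul_mk_eq_zero_iff S 1 m s

lemma exists_smul_eq_zero_of_fg {M : Type*} [AddCommGroup M] [Module R M] (I : Ideal R)
    (hI : I.FG) (m : M) (h : ∀ x ∈ I, ∃ u ∈ S, u • x • m = 0) :
    ∃ u ∈ S, ∀ x ∈ I, u • x • m = 0 := by
  induction I, hI using Submodule.fg_induction with
  | singleton x =>
    obtain ⟨u, hu, h⟩ := h x (Submodule.mem_span_singleton_self x)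
    refine ⟨u, hu, fun y hy => ?_⟩
    obtain ⟨r, rfl⟩ := Submodule.mem_span_singleton.1 hy
    rw [smul_assoc, smul_comm, h, smul_zero]
  | sup I₁ I₂ _ _ h₁ h₂ =>
    obtain ⟨u₁, hu₁, h₁⟩ := h₁ fun x hx => h x (Submodule.mem_sup_left hx)
    obtain ⟨u₂, hu₂, h₂⟩ := h₂ fun x hx => h x (Submodule.mem_sup_right hx)
    refine ⟨u₁ * u₂, S.mul_mem hu₁ hu₂, fun x hx => ?_⟩
    obtain ⟨x₁, hx₁, x₂, hx₂, rfl⟩ := Submodule.mem_sup.1 hx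
    rw [add_smul, smul_add, mul_comm u₁, mul_smul, h₁ _ hx₁, smul_zero, zero_add, mul_comm,
      mul_smul, h₂ _ hx₂, smul_zero]

lemma forall_mem_map_smul_eq_zero {M : Type*} [AddCommGroup M] [Module R M] (I : Ideal R)
    (z : LocalizedModule S M) :
    (∀ x ∈ I.map (algebraMap R (Localization S)), x • z = 0) ↔ ∀ x ∈ I, x • z = 0 := by
  constructor
  · intro h x hx
    rw [← algebraMap_smul (Localization S)]
    exact h _ (Ideal.mem_map_of_mem _ hx)
  · intro h x hx
    induction hx using Submodule.span_induction with
    | mem x hx =>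
      obtain ⟨x, hx, rfl⟩ := hx
      rw [algebraMap_smul, h x hx]
    | zero => simp
    | add x y _ _ h₁ h₂ => rw [add_smul, h₁, h₂, add_zero]
    | smul r x _ h => rw [smul_assoc, h, smul_zero]

/-- As `a ^ t` is finitely generated, a single denominator `u` clears all its relations on `m`; then
`u • m` is torsion in `M` itself. -/
lemma mem_gamma_localized_iff [IsNoetherianRing R] (a : Ideal R) {M : Type*} [AddCommGroup M]
    [Module R M] (z : LocalizedModule S M) :
    z ∈ gamma (a.map (algebraMap R (Localization S))) (LocalizedModule S M) ↔
      ∃ m ∈ gamma a M, ∃ s, LocalizedModule.mk m s = z := by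
  simp only [mem_gamma, ← Ideal.map_pow, forall_mem_map_smul_eq_zero]
  constructor
  · rintro ⟨t, ht⟩
    induction z with | _ m s
    simp only [smul_mk_eq_zero_iff] at ht
    obtain ⟨u, hu, h⟩ := exists_smul_eq_zero_of_fg S _ (IsNoetherian.noetherian (a ^ t)) m ht
    refine ⟨u • m, ⟨t, fun x hx => by rw [smul_comm, h x hx]⟩, ⟨u, hu⟩ * s, ?_⟩
    exact LocalizedModule.mk_cancel_common_left ⟨u, hu⟩ s m
  · rintro ⟨m, ⟨t, ht⟩, s, rfl⟩
    exact ⟨t, fun x hx => by rw [LocalizedModule.smul'_mk, ht x hx, LocalizedModule.zero_mk]⟩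

lemma range_map_gamma [IsNoetherianRing R] (a : Ideal R) (M : Type*) [AddCommGroup M]
    [Module R M] :
    LinearMap.range (LocalizedModule.map S (gamma a M).subtype) =
      gamma (a.map (algebraMap R (Localization S))) (LocalizedModule S M) := by
  ext z
  rw [mem_gamma_localized_iff]
  constructor
  · rintro ⟨w, rfl⟩
    induction w with | _ m s
    exact ⟨m, m.2, s, by simp⟩
  · rintro ⟨m, hm, s, rfl⟩
    exact ⟨LocalizedModule.mk ⟨m, hm⟩ s, by simp⟩

/-- The torsion submodule commutes with localization. -/
noncomputable def localizedGammaEquiv [IsNoetherianRing R] (a : Ideal R) (M : Type*)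
    [AddCommGroup M] [Module R M] :
    LocalizedModule S (gamma a M) ≃ₗ[Localization S]
      gamma (a.map (algebraMap R (Localization S))) (LocalizedModule S M) :=
  (LinearEquiv.ofInjective _ (LocalizedModule.map_injective S _
    (Submodule.subtype_injective _))).trans (LinearEquiv.ofEq _ _ (range_map_gamma S a M))

lemma coe_localizedGammaEquiv_mk [IsNoetherianRing R] (a : Ideal R) (M : Type*)
    [AddCommGroup M] [Module R M] (m : gamma a M) (s : S) :
    (localizedGammaEquiv S a M (LocalizedModule.mk m s) : LocalizedModule S M) =
      LocalizedModule.mk (m : M) s :=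
  LocalizedModule.map_mk S (gamma a M).subtype m s

lemma equiv_of_surjective_of_ker_eq {A : Type*} [CommRing A] {X Y Z : Type*} [AddCommGroup X]
    [Module A X] [AddCommGroup Y] [Module A Y] [AddCommGroup Z] [Module A Z] {f : X →ₗ[A] Y}
    {g : X →ₗ[A] Z} (hf : Function.Surjective f) (hg : Function.Surjective g)
    (h : ∀ x, f x = 0 ↔ g x = 0) : Nonempty (Y ≃ₗ[A] Z) :=
  ⟨(f.quotKerEquivOfSurjective hf).symm.trans ((Submodule.quotEquivOfEq _ _
    (by ext x; exact h x)).trans (g.quotKerEquivOfSurjective hg))⟩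

/-- Local cohomology commutes with localization. -/
theorem nonempty_localized_equiv [IsNoetherianRing R] (a : Ideal R) (i : ℕ) (M : Type u)
    [AddCommGroup M] [Module R M] :
    Nonempty (LocalizedModule S (H a i M) ≃ₗ[Localization S]
      H (a.map (algebraMap R (Localization S))) i (LocalizedModule S M)) := by
  have key : ∀ {X Y : Type u} [AddCommGroup X] [Module R X] [AddCommGroup Y] [Module R Y],
      (X ≃ₗ[R] Y) → (LocalizedModule S X ≃ₗ[Localization S] LocalizedModule S Y) :=
    fun e => IsLocalizedModule.mapEquiv S (LocalizedModule.mkLinearMap S _)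
      (LocalizedModule.mkLinearMap S _) (Localization S) e
  rcases i with _ | i
  · exact ⟨(key (zeroEquivGamma a M)).trans ((localizedGammaEquiv S a M).trans
      (zeroEquivGamma _ _).symm)⟩
  induction i generalizing M with
  | zero =>
    obtain ⟨E, f, _, hf⟩ := exists_injective_embedding R M
    have hfg := exact_mkQ_range f
    have hg := Submodule.mkQ_surjective (LinearMap.range f)
    generalize (LinearMap.range f).mkQ = g at hfg hg
    have hfS := LocalizedModule.map_injective S f hf
    have hgS := LocalizedModule.map_surjective S g hg
    have hfgS : Function.Exact (LocalizedModule.map S f) (LocalizedModule.map S g) :=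
      LocalizedModule.map_exact S f g hfg
    have : Module.Injective (Localization S) (LocalizedModule S E) :=
      Module.injective_of_isLocalizedModule S (LocalizedModule.mkLinearMap S E)
    obtain ⟨φ, hφ, hφ'⟩ := exists_gamma_surjection_one a hf hfg hg
    obtain ⟨ψ, hψ, hψ'⟩ := exists_gamma_surjection_one
      (a.map (algebraMap R (Localization S))) hfS hfgS hgS
    have hθ : Function.Surjective
        (ψ.comp (localizedGammaEquiv S a (E ⧸ LinearMap.range f)).toLinearMap) :=
      hψ.comp (localizedGammaEquiv S a (E ⧸ LinearMap.range f)).surjective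
    -- Both sides are quotients of the localization of `Γ(C)`; it remains to see that the kernels
    -- agree, which is a clearing of denominators.
    refine equiv_of_surjective_of_ker_eq
      (X := LocalizedModule S (gamma a (E ⧸ LinearMap.range f)))
      (Z := H (a.map (algebraMap R (Localization S))) 1 (LocalizedModule S M))
      (g := ψ.comp (localizedGammaEquiv S a (E ⧸ LinearMap.range f)).toLinearMap)
      (LocalizedModule.map_surjective S φ hφ) hθ fun w => ?_
    induction w with | _ c s
    rw [LocalizedModule.map_mk, mk_eq_zero_iff']
    simp only [LinearMap.comp_apply, LinearEquiv.coe_coe, hψ', ← map_smul, hφ',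
      mem_gamma_localized_iff]
    rw [coe_localizedGammaEquiv_mk]
    constructor
    · rintro ⟨u, hu, e, he, h⟩
      refine ⟨_, ⟨e, he, ⟨u, hu⟩ * s, rfl⟩, ?_⟩
      rw [LocalizedModule.map_mk, h]
      exact LocalizedModule.mk_cancel_common_left ⟨u, hu⟩ s (c : E ⧸ LinearMap.range f)
    · rintro ⟨_, ⟨e, he, s', rfl⟩, h⟩
      rw [LocalizedModule.map_mk, LocalizedModule.mk_eq] at h
      obtain ⟨u, hu⟩ := h
      refine ⟨u * s', S.mul_mem u.2 s'.2, ((u * s : S) : R) • e, Submodule.smul_mem _ _ he, ?_⟩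
      rw [map_smul]
      simpa [Submonoid.smul_def, mul_smul] using hu
  | succ i ih =>
    obtain ⟨E, f, _, hf⟩ := exists_injective_embedding R M
    have hfg := exact_mkQ_range f
    have hg := Submodule.mkQ_surjective (LinearMap.range f)
    generalize (LinearMap.range f).mkQ = g at hfg hg
    have hfS := LocalizedModule.map_injective S f hf
    have hgS := LocalizedModule.map_surjective S g hg
    have hfgS : Function.Exact (LocalizedModule.map S f) (LocalizedModule.map S g) :=
      LocalizedModule.map_exact S f g hfg
    have : Module.Injective (Localization S) (LocalizedModule S E) :=
      Module.injective_of_isLocalizedModule S (LocalizedModule.mkLinearMap S E)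
    obtain ⟨e₁⟩ := nonempty_shift_equiv a hf hfg hg i
    obtain ⟨e₂⟩ := nonempty_shift_equiv (a.map (algebraMap R (Localization S))) hfS hfgS hgS i
    obtain ⟨e₃⟩ := ih (E ⧸ LinearMap.range f)
    exact ⟨((key e₁).trans e₃).trans e₂.symm⟩

end Localization

/-! ### Classes of modules stable in exact sequences, applied to `Ext(R ⧸ a, -)`. -/

/-- A class of modules which contains the zero modules and, with the outer terms of a three term
exact sequence, its middle term. -/
structure IsExactClosed (P : ModuleCat.{u} R → Prop) : Prop where
  of_subsingleton : ∀ A : ModuleCat.{u} R, Subsingleton A → P A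
  of_exact : ∀ {A B C : ModuleCat.{u} R} (f : A →ₗ[R] B) (g : B →ₗ[R] C),
    (∀ b, g b = 0 → ∃ a, f a = b) → P A → P C → P B

/-- This class gives vanishing below the grade; the class of finite modules gives cofiniteness. -/
lemma isExactClosed_subsingleton :
    IsExactClosed (fun A : ModuleCat.{u} R => Subsingleton A) where
  of_subsingleton _ h := h
  of_exact {A B C} f g h hA hC := by
    have this : ∀ b : B, b = 0 := fun b => by
      obtain ⟨a, rfl⟩ := h b (Subsingleton.elim _ _)
      rw [Subsingleton.elim a 0, map_zero]
    exact ⟨fun x y => (this x).trans (this y).symm⟩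

lemma isExactClosed_finite [IsNoetherianRing R] :
    IsExactClosed (fun A : ModuleCat.{u} R => Module.Finite R A) where
  of_subsingleton _ h := inferInstance
  of_exact {A B C} f g h hA hC := by
    have h₁ : Module.Finite R (LinearMap.ker g) := by
      have : Module.Finite R (LinearMap.range f) := inferInstance
      have hle : LinearMap.ker g ≤ LinearMap.range f := fun b hb => h b hb
      exact Module.Finite.of_injective (Submodule.inclusion hle) (Submodule.inclusion_injective hle)
    have h₂ : Module.Finite R (LinearMap.range g) := inferInstance
    have h₃ : Module.Finite R (B ⧸ LinearMap.ker g) :=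
      Module.Finite.equiv g.quotKerEquivRange.symm
    exact Module.Finite.of_submodule_quotient (LinearMap.ker g)

/-- `Ext^k(R ⧸ a, L)`. -/
noncomputable abbrev extQuot (a : Ideal R) (k : ℕ) (L : Type u) [AddCommGroup L] [Module R L] :
    ModuleCat.{u} R :=
  ModuleCat.of R (Abelian.Ext (ModuleCat.of R (R ⧸ a)) (ModuleCat.of R L) k)

namespace IsExactClosed

variable {P : ModuleCat.{u} R → Prop} (hP : IsExactClosed P) {a : Ideal R}
include hP

lemma of_injective {A B : ModuleCat.{u} R} (f : A →ₗ[R] B) (hf : Function.Injective f)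
    (h : P B) : P A :=
  hP.of_exact (A := ModuleCat.of R PUnit) 0 f
    (fun b hb => ⟨0, by simpa using (hf (hb.trans (map_zero f).symm)).symm⟩)
    (hP.of_subsingleton _ (inferInstanceAs (Subsingleton PUnit))) h

lemma of_surjective {A B : ModuleCat.{u} R} (f : A →ₗ[R] B) (hf : Function.Surjective f)
    (h : P A) : P B :=
  hP.of_exact (C := ModuleCat.of R PUnit) f 0 (fun b _ => hf b) h
    (hP.of_subsingleton _ (inferInstanceAs (Subsingleton PUnit)))

/-- The range of `θ` is a quotient of `A ⧸ ker δ`, which embeds into `B`. -/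
lemma range_of_ker_le {A B C : ModuleCat.{u} R} (δ : A →ₗ[R] B) (θ : A →ₗ[R] C)
    (h : ∀ x, δ x = 0 → θ x = 0) (hB : P B) : P (ModuleCat.of R (LinearMap.range θ)) := by
  have h₁ : P (ModuleCat.of R (A ⧸ LinearMap.ker δ)) :=
    hP.of_injective (A := ModuleCat.of R (A ⧸ LinearMap.ker δ)) ((LinearMap.ker δ).liftQ δ le_rfl)
      (LinearMap.ker_eq_bot.1 (Submodule.ker_liftQ_eq_bot _ _ _ le_rfl)) hB
  refine hP.of_surjective (A := ModuleCat.of R (A ⧸ LinearMap.ker δ))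
    (B := ModuleCat.of R (LinearMap.range θ))
    ((LinearMap.ker δ).liftQ θ.rangeRestrict fun x hx => Subtype.ext (h x hx)) ?_ h₁
  rintro ⟨_, x, rfl⟩
  exact ⟨Submodule.Quotient.mk x, rfl⟩

variable {A B C : Type u} [AddCommGroup A] [Module R A] [AddCommGroup B] [Module R B]
  [AddCommGroup C] [Module R C] {f : A →ₗ[R] B} {g : B →ₗ[R] C}

lemma ext_equiv (e : A ≃ₗ[R] B) (k : ℕ) (h : P (extQuot a k A)) : P (extQuot a k B) := by
  refine hP.of_surjective ((Ext.mk₀ (ModuleCat.ofHom e.toLinearMap)).postcompOfLinear R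
    (ModuleCat.of R (R ⧸ a)) (add_zero k)) (fun x => ?_) h
  refine ⟨x.comp (Ext.mk₀ (ModuleCat.ofHom e.symm.toLinearMap)) (add_zero k), ?_⟩
  have : ModuleCat.ofHom e.symm.toLinearMap ≫ ModuleCat.ofHom e.toLinearMap =
      𝟙 (ModuleCat.of R B) := by ext; simp
  simp [this]

lemma ext_middle (hf : Function.Injective f) (hfg : Function.Exact f g)
    (hg : Function.Surjective g) (k : ℕ) (hA : P (extQuot a k A)) (hC : P (extQuot a k C)) :
    P (extQuot a k B) := by
  have hS := shortExact_of_linearMap hf hfg hg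
  exact hP.of_exact ((Ext.mk₀ (ModuleCat.ofHom f)).postcompOfLinear R (ModuleCat.of R (R ⧸ a))
    (add_zero k)) ((Ext.mk₀ (ModuleCat.ofHom g)).postcompOfLinear R (ModuleCat.of R (R ⧸ a))
    (add_zero k)) (fun x hx => Ext.covariant_sequence_exact₂ _ hS x hx) hA hC

lemma ext_right (hf : Function.Injective f) (hfg : Function.Exact f g)
    (hg : Function.Surjective g) (k : ℕ) (hB : P (extQuot a k B)) (hA : P (extQuot a (k + 1) A)) :
    P (extQuot a k C) := by
  have hS := shortExact_of_linearMap hf hfg hg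
  exact hP.of_exact ((Ext.mk₀ (ModuleCat.ofHom g)).postcompOfLinear R (ModuleCat.of R (R ⧸ a))
    (add_zero k)) (hS.extClass.postcompOfLinear R (ModuleCat.of R (R ⧸ a)) rfl)
    (fun x hx => Ext.covariant_sequence_exact₃ _ hS x rfl hx) hB hA

lemma ext_left (hf : Function.Injective f) (hfg : Function.Exact f g)
    (hg : Function.Surjective g) (k : ℕ) (hC : P (extQuot a k C)) (hB : P (extQuot a (k + 1) B)) :
    P (extQuot a (k + 1) A) := by
  have hS := shortExact_of_linearMap hf hfg hg
  exact hP.of_exact (hS.extClass.postcompOfLinear R (ModuleCat.of R (R ⧸ a)) rfl)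
    ((Ext.mk₀ (ModuleCat.ofHom f)).postcompOfLinear R (ModuleCat.of R (R ⧸ a))
    (add_zero (k + 1))) (fun x hx => Ext.covariant_sequence_exact₁ _ hS x hx rfl) hC hB

lemma ext_zero_of_injective (hf : Function.Injective f) (hB : P (extQuot a 0 B)) :
    P (extQuot a 0 A) := by
  have : Mono (ModuleCat.ofHom f) := (ModuleCat.mono_iff_injective _).2 hf
  exact hP.of_injective ((Ext.mk₀ (ModuleCat.ofHom f)).postcompOfLinear R (ModuleCat.of R (R ⧸ a))
    (add_zero 0)) (Ext.postcomp_mk₀_injective_of_mono _ _) hB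

lemma ext_succ_of_injective_module [Module.Injective R A] (k : ℕ) : P (extQuot a (k + 1) A) := by
  have : Injective (ModuleCat.of R A) := Module.injective_object_of_injective_module R A
  refine hP.of_subsingleton _ ⟨fun x y => ?_⟩
  exact (Ext.eq_zero_of_injective x).trans (Ext.eq_zero_of_injective y).symm

lemma ext_of_subsingleton [Subsingleton A] (k : ℕ) : P (extQuot a k A) := by
  have h₀ : 𝟙 (ModuleCat.of R A) = 0 := by ext x; exact Subsingleton.elim (α := A) _ _
  have h : ∀ x : extQuot a k A, x = 0 := fun x => by
    refine (Ext.comp_mk₀_id x).symm.trans ?_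
    rw [h₀, Ext.mk₀_zero, Ext.comp_zero]
  exact hP.of_subsingleton _ ⟨fun x y => (h x).trans (h y).symm⟩

end IsExactClosed

/-- If `a m` is torsion then, being finitely generated, it is killed by one power `a ^ t`, whence `a
^ (t + 1) m = 0`. -/
lemma eq_zero_of_quotient_gamma [IsNoetherianRing R] (a : Ideal R) (M : Type*) [AddCommGroup M]
    [Module R M] (z : M ⧸ gamma a M) (hz : ∀ x ∈ a, x • z = 0) : z = 0 := by
  obtain ⟨m, rfl⟩ := Submodule.Quotient.mk_surjective _ z
  have hle : a • Submodule.span R {m} ≤ gamma a M := by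
    refine Submodule.smul_le.2 fun x hx n hn => ?_
    obtain ⟨r, rfl⟩ := Submodule.mem_span_singleton.1 hn
    rw [smul_comm]
    exact Submodule.smul_mem _ _ ((Submodule.Quotient.mk_eq_zero _).1 (hz x hx))
  obtain ⟨t, ht⟩ := exists_pow_smul_eq_zero_of_fg (a • Submodule.span R {m})
    (Submodule.FG.smul (IsNoetherian.noetherian a) (Submodule.fg_span_singleton m)) hle
  refine (Submodule.Quotient.mk_eq_zero _).2 ⟨t + 1, fun x hx => ?_⟩
  rw [pow_succ] at hx
  refine Submodule.smul_induction_on (p := fun x => x • m = 0) hx (fun y hy x hx => ?_)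
    (fun x y h₁ h₂ => by rw [add_smul, h₁, h₂, add_zero])
  rw [smul_assoc]
  exact ht y hy _ (Submodule.smul_mem_smul hx (Submodule.mem_span_singleton_self m))

lemma smul_apply_eq_zero {a : Ideal R} {L : ModuleCat.{u} R} (ξ : ModuleCat.of R (R ⧸ a) ⟶ L)
    (r : R ⧸ a) (x : R) (hx : x ∈ a) : x • ξ r = 0 := by
  refine (map_smul ξ.hom x r).symm.trans ?_
  obtain ⟨r, rfl⟩ := Ideal.Quotient.mk_surjective r
  refine (congrArg ξ.hom ?_).trans (map_zero ξ.hom)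
  exact (Submodule.Quotient.mk_eq_zero _).2 (a.mul_mem_right r hx)

/-- Since `Hom(R ⧸ a, C ⧸ Γ(C)) = 0`, the module `Ext¹(R ⧸ a, Γ(C))` embeds into `Ext¹(R ⧸ a, C)`.
-/
lemma IsExactClosed.ext_one_gamma [IsNoetherianRing R] {P : ModuleCat.{u} R → Prop}
    (hP : IsExactClosed P) {a : Ideal R} {C : Type u} [AddCommGroup C] [Module R C]
    (h : P (extQuot a 1 C)) : P (extQuot a 1 (gamma a C)) := by
  refine hP.ext_left (Submodule.subtype_injective _)
    (LinearMap.exact_iff.2 (by simp)) (Submodule.mkQ_surjective (gamma a C)) 0 ?_ h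
  have h₀ : ∀ x : extQuot a 0 (C ⧸ gamma a C), x = 0 := fun x => by
    obtain ⟨ξ, rfl⟩ := (Ext.mk₀_bijective _ _).2 x
    have : ξ = 0 := by
      ext
      exact eq_zero_of_quotient_gamma a C _ fun x hx => smul_apply_eq_zero ξ _ x hx
    rw [this, Ext.mk₀_zero]
  exact hP.of_subsingleton _ ⟨fun x y => (h₀ x).trans (h₀ y).symm⟩

section Sequence

variable {M E C : Type u} [AddCommGroup M] [Module R M] [AddCommGroup E] [Module R E]
  [AddCommGroup C] [Module R C]

/-- The map induced on torsion submodules. -/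
def gammaMap (a : Ideal R) (f : M →ₗ[R] E) : gamma a M →ₗ[R] gamma a E :=
  f.restrict fun m hm => by
    obtain ⟨t, ht⟩ := hm
    exact ⟨t, fun x hx => by rw [← map_smul, ht x hx, map_zero]⟩

/-- A torsion sequence `0 → Γ(M) → Γ(E) → K → 0` with `K = ker (Γ(C) → H¹(M))`. -/
lemma exists_gamma_sequence (a : Ideal R) {f : M →ₗ[R] E} {g : E →ₗ[R] C}
    (hf : Function.Injective f) (hfg : Function.Exact f g) {L : Type u} [AddCommGroup L] [Module R L]
    (φ : gamma a C →ₗ[R] L) (hφ : ∀ z, φ z = 0 ↔ ∃ e ∈ gamma a E, g e = z) :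
    ∃ γ : gamma a E →ₗ[R] LinearMap.ker φ, Function.Injective (gammaMap a f) ∧
      Function.Exact (gammaMap a f) γ ∧ Function.Surjective γ := by
  refine ⟨(gammaMap a g).codRestrict _ fun e => (hφ _).2 ⟨e, e.2, rfl⟩, ?_, ?_, ?_⟩
  · intro x y h
    exact Subtype.ext (hf (congrArg Subtype.val h))
  · intro e
    constructor
    · intro h
      have h' : g e = 0 := congrArg (fun z : LinearMap.ker φ => ((z : gamma a C) : C)) h
      obtain ⟨m, hm⟩ := (hfg e).1 h'
      obtain ⟨t, ht⟩ := e.2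
      refine ⟨⟨m, t, fun x hx => hf ?_⟩, Subtype.ext hm⟩
      rw [map_smul, hm, ht x hx, map_zero]
    · rintro ⟨m, rfl⟩
      refine Subtype.ext (Subtype.ext ?_)
      exact hfg.apply_apply_eq_zero m
  · rintro ⟨z, hz⟩
    obtain ⟨e, he, h⟩ := (hφ z).1 hz
    exact ⟨⟨e, he⟩, Subtype.ext (Subtype.ext h)⟩

end Sequence

namespace IsExactClosed

variable [IsNoetherianRing R] {P : ModuleCat.{u} R → Prop} (hP : IsExactClosed P) {a : Ideal R}
  {M E C : Type u} [AddCommGroup M] [Module R M] [AddCommGroup E] [Module R E]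
  [AddCommGroup C] [Module R C] [Module.Injective R E] {f : M →ₗ[R] E} {g : E →ₗ[R] C}
  (hf : Function.Injective f) (hfg : Function.Exact f g) (hg : Function.Surjective g)
  {L : Type u} [AddCommGroup L] [Module R L]
  {φ : gamma a C →ₗ[R] L} (hφ : Function.Surjective φ)
  (hφ' : ∀ z, φ z = 0 ↔ ∃ e ∈ gamma a E, g e = z)
include hP hf hfg hφ'

/-- In `0 → Γ(M) → Γ(E) → ker φ → 0` the middle term is injective, which shifts the degree by one.
-/
lemma ext_ker (k : ℕ) (hM : P (extQuot a (k + 2) (gamma a M))) :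
    P (extQuot a (k + 1) (LinearMap.ker φ)) := by
  obtain ⟨γ, h₁, h₂, h₃⟩ := exists_gamma_sequence a hf hfg φ hφ'
  have := injective_gamma a E
  exact hP.ext_right h₁ h₂ h₃ (k + 1) (hP.ext_succ_of_injective_module k) hM

include hφ

lemma ext_gamma_quotient (k : ℕ) (hM : P (extQuot a (k + 2) (gamma a M)))
    (hL : P (extQuot a (k + 1) L)) : P (extQuot a (k + 1) (gamma a C)) :=
  hP.ext_middle (Submodule.subtype_injective _) (LinearMap.exact_subtype_ker_map φ) hφ (k + 1)
    (hP.ext_ker hf hfg hφ' k hM) hL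

include hg

lemma ext_one_cokernel (hM : P (extQuot a 3 (gamma a M))) (h : P (extQuot a 2 M)) :
    P (extQuot a 1 L) := by
  have hC : P (extQuot a 1 C) :=
    hP.ext_right hf hfg hg 1 (hP.ext_succ_of_injective_module 0) h
  exact hP.ext_right (Submodule.subtype_injective _) (LinearMap.exact_subtype_ker_map φ) hφ 1
    (hP.ext_one_gamma hC) (hP.ext_ker hf hfg hφ' 1 hM)

/-- Nothing is known about `Hom(R ⧸ a, C)`, since `Hom(R ⧸ a, E)` need not be in the class. Instead,
the image of `Hom(R ⧸ a, Γ(C))` in `Hom(R ⧸ a, L)` is a subquotient of `Ext¹(R ⧸ a, M)`: a map with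
zero connecting class lifts to `E`, the lift takes values in `Γ(E)`, and so its image in `L` is
zero. -/
lemma ext_zero_cokernel (hM : P (extQuot a 2 (gamma a M))) (h : P (extQuot a 1 M)) :
    P (extQuot a 0 L) := by
  have hS := shortExact_of_linearMap hf hfg hg
  have hS' := shortExact_of_linearMap (Submodule.subtype_injective _)
    (LinearMap.exact_subtype_ker_map φ) hφ
  let θ : extQuot a 0 (gamma a C) →ₗ[R] extQuot a 0 L :=
    (Ext.mk₀ (ModuleCat.ofHom φ)).postcompOfLinear R (ModuleCat.of R (R ⧸ a)) (add_zero 0)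
  let δ : extQuot a 0 (gamma a C) →ₗ[R] extQuot a 1 M :=
    (hS.extClass.postcompOfLinear R (ModuleCat.of R (R ⧸ a)) (zero_add 1)).comp
      ((Ext.mk₀ (ModuleCat.ofHom (gamma a C).subtype)).postcompOfLinear R
        (ModuleCat.of R (R ⧸ a)) (add_zero 0))
  have hrange : P (ModuleCat.of R (LinearMap.range θ)) := by
    refine hP.range_of_ker_le δ θ (fun x hx => ?_) h
    obtain ⟨y, hy⟩ := Ext.covariant_sequence_exact₃ _ hS _ (zero_add 1) hx
    obtain ⟨ξ, rfl⟩ := (Ext.mk₀_bijective _ _).2 x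
    obtain ⟨η, rfl⟩ := (Ext.mk₀_bijective _ _).2 y
    have hy' : Ext.mk₀ (η ≫ ModuleCat.ofHom g) =
        Ext.mk₀ (ξ ≫ ModuleCat.ofHom (gamma a C).subtype) :=
      (Ext.mk₀_comp_mk₀ _ _).symm.trans (hy.trans (Ext.mk₀_comp_mk₀ _ _))
    have hξη := (Ext.mk₀_bijective _ _).1 hy'
    have hzero : ξ ≫ ModuleCat.ofHom φ = 0 := by
      ext
      refine (hφ' _).2 ⟨η _, ⟨1, fun x hx => ?_⟩, congr($hξη _)⟩
      exact smul_apply_eq_zero η _ x (by simpa using hx)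
    change (Ext.mk₀ ξ).comp (Ext.mk₀ (ModuleCat.ofHom φ)) (add_zero 0) = 0
    rw [Ext.mk₀_comp_mk₀, hzero, Ext.mk₀_zero]
  refine hP.of_exact (A := ModuleCat.of R (LinearMap.range θ)) (LinearMap.range θ).subtype
    (hS'.extClass.postcompOfLinear R (ModuleCat.of R (R ⧸ a)) (zero_add 1)) (fun x hx => ?_)
    hrange (hP.ext_ker hf hfg hφ' 0 hM)
  obtain ⟨y, hy⟩ := Ext.covariant_sequence_exact₃ _ hS' x (zero_add 1) hx
  exact ⟨⟨x, y, hy⟩, rfl⟩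

end IsExactClosed

/-- If the local cohomology modules below degree `i` have all their `Ext(R ⧸ a, -)` in the class
`P`, then `Hom(R ⧸ a, H^i)` and `Ext¹(R ⧸ a, H^i)` are in the class as soon as `Ext^i(R ⧸ a, M)`
and `Ext^{i+1}(R ⧸ a, M)` are. -/
theorem IsExactClosed.ext_localCohomology_succ [IsNoetherianRing R] {P : ModuleCat.{u} R → Prop}
    (hP : IsExactClosed P) {a : Ideal R} (i : ℕ) (M : Type u) [AddCommGroup M] [Module R M]
    (h₀ : ∀ k, P (extQuot a (k + 2) (gamma a M)))
    (hH : ∀ j < i, ∀ k, P (extQuot a k (H a (j + 1) M))) :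
    (P (extQuot a (i + 1) M) → P (extQuot a 0 (H a (i + 1) M))) ∧
      (P (extQuot a (i + 2) M) → P (extQuot a 1 (H a (i + 1) M))) := by
  induction i generalizing M with
  | zero =>
    obtain ⟨E, f, _, hf⟩ := exists_injective_embedding R M
    obtain ⟨φ, hφ, hφ'⟩ := exists_gamma_surjection_one a hf (exact_mkQ_range f)
      (Submodule.mkQ_surjective _)
    exact ⟨hP.ext_zero_cokernel hf (exact_mkQ_range f) (Submodule.mkQ_surjective _) hφ hφ' (h₀ 0),
      hP.ext_one_cokernel hf (exact_mkQ_range f) (Submodule.mkQ_surjective _) hφ hφ' (h₀ 1)⟩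
  | succ i ih =>
    obtain ⟨E, f, _, hf⟩ := exists_injective_embedding R M
    have hfg := exact_mkQ_range f
    have hg := Submodule.mkQ_surjective (LinearMap.range f)
    obtain ⟨φ, hφ, hφ'⟩ := exists_gamma_surjection_one a hf hfg hg
    -- Passing to `C = E ⧸ M` lowers all degrees by one. The hypothesis on `Γ(C)` comes from `Γ(M)`
    -- and `H^1_a(M)`, hence the index `0` in `hH`.
    have hC := ih (E ⧸ LinearMap.range f)
      (fun k => hP.ext_gamma_quotient hf hfg hφ hφ' (k + 1) (h₀ (k + 1))
        (hH 0 (Nat.succ_pos i) _))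
      (fun j hj k => by
        obtain ⟨e⟩ := nonempty_shift_equiv a hf hfg hg j
        exact hP.ext_equiv e k (hH (j + 1) (Nat.succ_lt_succ hj) k))
    obtain ⟨e⟩ := nonempty_shift_equiv a hf hfg hg i
    refine ⟨fun h => hP.ext_equiv e.symm 0 (hC.1 ?_), fun h => hP.ext_equiv e.symm 1 (hC.2 ?_)⟩
    · exact hP.ext_right hf hfg hg _ (hP.ext_succ_of_injective_module i) h
    · exact hP.ext_right hf hfg hg _ (hP.ext_succ_of_injective_module (i + 1)) h

/-! ### Artinian torsion modules and general elements. -/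

section Artinian

variable {L : Type*} [AddCommGroup L] [Module R L]

/-- The submodule `x ^ k N ∩ (0 :_L x)`, regarded inside `(0 :_L x)`. -/
def powTorsion (x : R) (k : ℕ) (N : Submodule R L) : Submodule R (Submodule.torsionBy R L x) :=
  (N.map (LinearMap.lsmul R L (x ^ k))).comap (Submodule.torsionBy R L x).subtype

lemma mem_powTorsion {x : R} {k : ℕ} {N : Submodule R L} {z : Submodule.torsionBy R L x} :
    z ∈ powTorsion x k N ↔ ∃ n ∈ N, x ^ k • n = z := by
  simp [powTorsion, Submodule.mem_map]

lemma powTorsion_le {x : R} {k k' : ℕ} {N N' : Submodule R L} (hk : k' ≤ k) (hN : N ≤ N') :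
    powTorsion x k N ≤ powTorsion x k' N' := by
  intro z hz
  obtain ⟨n, hn, h⟩ := mem_powTorsion.1 hz
  refine mem_powTorsion.2 ⟨x ^ (k - k') • n, hN (N.smul_mem _ hn), ?_⟩
  rw [smul_smul, ← pow_add, Nat.add_sub_cancel' hk, h]

/-- If `x ^ (k + 1) z = 0`, then `x ^ k z` lies in `(0 :_L x)` and equals `x ^ k n` for some `n ∈
N`; now `z - n` is killed by `x ^ k`. -/
lemma le_of_powTorsion_le {x : R} (hx : ∀ z : L, ∃ k : ℕ, x ^ k • z = 0) {N N' : Submodule R L}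
    (hN : N ≤ N') (h : ∀ k, powTorsion x k N' ≤ powTorsion x k N) : N' ≤ N := by
  have key : ∀ k : ℕ, ∀ z ∈ N', x ^ k • z = 0 → z ∈ N := by
    intro k
    induction k with
    | zero =>
      intro z _ h0
      rw [pow_zero, one_smul] at h0
      exact h0 ▸ N.zero_mem
    | succ k ih =>
      intro z hz h0
      have h1 : x ^ k • z ∈ Submodule.torsionBy R L x := by
        rw [Submodule.mem_torsionBy_iff, smul_smul, ← pow_succ', h0]
      obtain ⟨n, hn, hnz⟩ := mem_powTorsion.1
        (h k (mem_powTorsion.2 ⟨z, hz, rfl⟩ : (⟨_, h1⟩ : Submodule.torsionBy R L x) ∈ _))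
      have h2 := ih (z - n) (N'.sub_mem hz (hN hn)) (by rw [smul_sub, hnz, sub_self])
      simpa using N.add_mem h2 hn
  intro z hz
  obtain ⟨k, hk⟩ := hx z
  exact key k z hz hk

/-- A module which is torsion with respect to `x` is artinian if `(0 :_L x)` is. -/
lemma isArtinian_of_torsionBy {x : R} (hx : ∀ z : L, ∃ k : ℕ, x ^ k • z = 0)
    [IsArtinian R (Submodule.torsionBy R L x)] : IsArtinian R L := by
  refine monotone_stabilizes_iff_artinian.1 fun N => ?_
  have hN : ∀ {i j : ℕ}, i ≤ j → OrderDual.ofDual (N j) ≤ OrderDual.ofDual (N i) :=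
    fun h => N.monotone h
  have stab := monotone_stabilizes_iff_artinian.2 ‹IsArtinian R (Submodule.torsionBy R L x)›
  -- The diagonal chain settles all rows `k ≥ n₀` at once, by comparison at index `max k m`; the
  -- finitely many rows `k < n₀` stabilize separately.
  obtain ⟨n₀, h₀⟩ := stab
    ⟨fun n => OrderDual.toDual (powTorsion x n (OrderDual.ofDual (N n))),
      fun i j h => powTorsion_le h (hN h)⟩
  have hrow : ∀ k, ∃ n, ∀ m, n ≤ m →
      powTorsion x k (OrderDual.ofDual (N n)) = powTorsion x k (OrderDual.ofDual (N m)) := fun k =>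
    stab ⟨fun n => OrderDual.toDual (powTorsion x k (OrderDual.ofDual (N n))),
      fun i j h => powTorsion_le le_rfl (hN h)⟩
  choose s hs using hrow
  let n₁ := n₀ + (Finset.range n₀).sup s
  refine ⟨n₁, fun m hm => le_antisymm (N.monotone hm) ?_⟩
  refine le_of_powTorsion_le hx (hN hm) fun k => ?_
  by_cases hk : k < n₀
  · have hsk : s k ≤ n₁ := (Finset.le_sup (Finset.mem_range.2 hk)).trans (Nat.le_add_left _ _)
    exact ((hs k n₁ hsk).symm.trans (hs k m (hsk.trans hm))).le
  · push Not at hk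
    have h₁ : n₀ ≤ n₁ := Nat.le_add_right _ _
    have h₂ : powTorsion x n₀ (OrderDual.ofDual (N n₀)) =
        powTorsion x (max k m) (OrderDual.ofDual (N (max k m))) :=
      h₀ (max k m) (hk.trans (le_max_left _ _))
    calc _ ≤ powTorsion x n₀ (OrderDual.ofDual (N n₀)) := powTorsion_le hk (hN h₁)
      _ ≤ _ := h₂.le
      _ ≤ _ := powTorsion_le (le_max_left _ _) (hN (le_max_right _ _))

lemma isArtinian_of_torsionBySet_finset (s : Finset R) {L : Type*} [AddCommGroup L] [Module R L]
    (hs : ∀ x ∈ s, ∀ z : L, ∃ k : ℕ, x ^ k • z = 0)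
    [hA : IsArtinian R (Submodule.torsionBySet R L (s : Set R))] : IsArtinian R L := by
  classical
  induction s using Finset.induction_on generalizing L with
  | empty =>
    exact isArtinian_of_injective
      (LinearMap.id.codRestrict (Submodule.torsionBySet R L ((∅ : Finset R) : Set R))
        fun z => (Submodule.mem_torsionBySet_iff _ _).2 fun x => absurd x.2 (by simp))
      (fun x y h => congrArg Subtype.val h)
  | insert x s hxs ih =>
    have : IsArtinian R (Submodule.torsionBySet R (Submodule.torsionBy R L x) (s : Set R)) := by
      refine isArtinian_of_injective (P := Submodule.torsionBySet R L ((insert x s : Finset R) : Set R))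
        (LinearMap.codRestrict _ ((Submodule.torsionBy R L x).subtype ∘ₗ
          (Submodule.torsionBySet R (Submodule.torsionBy R L x) (s : Set R)).subtype) ?_) ?_
      · intro z
        refine (Submodule.mem_torsionBySet_iff _ _).2 ?_
        rintro ⟨y, hy⟩
        rcases Finset.mem_insert.1 (Finset.mem_coe.1 hy) with rfl | hy
        · exact z.1.2
        · exact congrArg Subtype.val ((Submodule.mem_torsionBySet_iff _ _).1 z.2 ⟨y, hy⟩)
      · intro z w h
        have h' := congrArg Subtype.val h
        exact Subtype.ext (Subtype.ext h')
    have : IsArtinian R (Submodule.torsionBy R L x) := ih fun y hy z => by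
      obtain ⟨k, hk⟩ := hs y (Finset.mem_insert_of_mem hy) z
      exact ⟨k, Subtype.ext hk⟩
    exact isArtinian_of_torsionBy (hs x (Finset.mem_insert_self _ _))

/-- A torsion module with respect to `a` is artinian if `(0 :_L a)` is. -/
theorem isArtinian_of_torsionBySet [IsNoetherianRing R] {a : Ideal R} (h : ∀ z : L, z ∈ gamma a L)
    [IsArtinian R (Submodule.torsionBySet R L (a : Set R))] : IsArtinian R L := by
  obtain ⟨s, hs⟩ := IsNoetherian.noetherian a
  have : IsArtinian R (Submodule.torsionBySet R L (s : Set R)) := by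
    rw [Submodule.torsionBySet_eq_torsionBySet_span]
    change IsArtinian R (Submodule.torsionBySet R L ((Submodule.span R (s : Set R) : Ideal R) : Set R))
    rwa [hs]
  refine isArtinian_of_torsionBySet_finset s fun x hx z => ?_
  obtain ⟨t, ht⟩ := h z
  exact ⟨t, ht _ (Ideal.pow_mem_pow (hs ▸ Submodule.subset_span hx) t)⟩

/-- A finitely generated module supported at maximal ideals is artinian. -/
lemma isArtinian_of_support [IsNoetherianRing R] [Module.Finite R L]
    (h : ∀ p ∈ Module.support R L, p.asIdeal.IsMaximal) : IsArtinian R L := by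
  have hdim : Ring.KrullDimLE 0 (R ⧸ Module.annihilator R L) := by
    refine Ring.krullDimLE_zero_iff.2 fun I hI => ?_
    have hp : (I.comap (Ideal.Quotient.mk (Module.annihilator R L))).IsPrime := inferInstance
    have : (I.comap (Ideal.Quotient.mk (Module.annihilator R L))).IsMaximal := by
      refine h ⟨_, hp⟩ ?_
      rw [Module.support_eq_zeroLocus, PrimeSpectrum.mem_zeroLocus]
      intro x hx
      change Ideal.Quotient.mk _ x ∈ I
      rw [Ideal.Quotient.eq_zero_iff_mem.2 hx]
      exact I.zero_mem
    have hmap := Ideal.map_comap_of_surjective (Ideal.Quotient.mk (Module.annihilator R L))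
      Ideal.Quotient.mk_surjective I
    have := (Ideal.map_eq_top_or_isMaximal_of_surjective _ Ideal.Quotient.mk_surjective
      this).resolve_left (by rw [hmap]; exact hI.ne_top)
    rwa [hmap] at this
  have : IsArtinianRing (R ⧸ Module.annihilator R L) :=
    isArtinianRing_iff_isNoetherianRing_krullDimLE_zero.2 ⟨inferInstance, hdim⟩
  let : Module (R ⧸ Module.annihilator R L) L := Module.quotientAnnihilator
  have : IsScalarTower R (R ⧸ Module.annihilator R L) L := inferInstance
  have : Module.Finite (R ⧸ Module.annihilator R L) L := Module.Finite.of_restrictScalars_finite R _ _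
  have : IsArtinian (R ⧸ Module.annihilator R L) L := inferInstance
  exact isArtinian_of_surjective_algebraMap (R := R ⧸ Module.annihilator R L)
    Ideal.Quotient.mk_surjective

/-- An artinian module which is not the sum of two proper submodules is secondary. -/
lemma smul_top_eq_or_isNilpotent [IsArtinian R L]
    (h : ∀ N₁ N₂ : Submodule R L, N₁ ⊔ N₂ = ⊤ → N₁ = ⊤ ∨ N₂ = ⊤) (x : R) :
    (⊤ : Submodule R L).map (LinearMap.lsmul R L x) = ⊤ ∨ ∃ k : ℕ, ∀ z : L, x ^ k • z = 0 := by
  obtain ⟨k, hk⟩ := monotone_stabilizes_iff_artinian.2 ‹IsArtinian R L›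
    ⟨fun k => OrderDual.toDual (LinearMap.range (LinearMap.lsmul R L (x ^ k))), fun i j hij => by
      rintro _ ⟨z, rfl⟩
      refine ⟨x ^ (j - i) • z, ?_⟩
      simp only [LinearMap.lsmul_apply, smul_smul, ← pow_add, Nat.add_sub_cancel' hij]⟩
  have hkk : LinearMap.range (LinearMap.lsmul R L (x ^ k)) =
      LinearMap.range (LinearMap.lsmul R L (x ^ (k + k + 1))) := hk (k + k + 1) (by omega)
  -- Fitting's argument: once the images of the powers of `x` are stationary, `L = x ^ (k + 1) L +
  -- ker x ^ k`.
  have hsum : LinearMap.range (LinearMap.lsmul R L (x ^ (k + 1))) ⊔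
      LinearMap.ker (LinearMap.lsmul R L (x ^ k)) = ⊤ := by
    refine eq_top_iff.2 fun z _ => ?_
    obtain ⟨w, hw⟩ : x ^ k • z ∈ LinearMap.range (LinearMap.lsmul R L (x ^ (k + k + 1))) :=
      hkk ▸ ⟨z, rfl⟩
    rw [LinearMap.lsmul_apply] at hw
    refine Submodule.mem_sup.2 ⟨x ^ (k + 1) • w, ⟨w, rfl⟩, z - x ^ (k + 1) • w, ?_, by abel⟩
    rw [LinearMap.mem_ker, LinearMap.lsmul_apply, smul_sub, smul_smul, ← pow_add, ← add_assoc, hw,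
      sub_self]
  rcases h _ _ hsum with h₁ | h₁
  · left
    refine eq_top_iff.2 fun z _ => ?_
    obtain ⟨w, rfl⟩ : z ∈ LinearMap.range (LinearMap.lsmul R L (x ^ (k + 1))) := h₁ ▸ trivial
    exact ⟨x ^ k • w, trivial, by simp only [LinearMap.lsmul_apply, smul_smul, ← pow_succ']⟩
  · right
    refine ⟨k, fun z => ?_⟩
    have : z ∈ LinearMap.ker (LinearMap.lsmul R L (x ^ k)) := h₁ ▸ trivial
    exact this

/-- For an artinian module `L` such that all `(0 :_L a ^ t)` are finitely generated, a general
element `x` of `a` has the property that `L / x L` is finitely generated. -/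
theorem exists_primes_of_isArtinian [IsNoetherianRing R] [IsArtinian R L] (a : Ideal R)
    (hfg : ∀ t : ℕ, (Submodule.torsionBySet R L ((a ^ t : Ideal R) : Set R)).FG) :
    ∃ S : Finset (Ideal R), (∀ P ∈ S, P.IsPrime ∧ ¬ a ≤ P) ∧ ∀ x ∈ a, (∀ P ∈ S, x ∉ P) →
      ∃ F : Submodule R L, F.FG ∧ F ⊔ (⊤ : Submodule R L).map (LinearMap.lsmul R L x) = ⊤ := by
  classical
  -- A secondary decomposition in disguise: by induction on submodules, `N` is a sum of two smaller
  -- ones or secondary. The set `S` collects attached primes not containing `a`.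
  suffices key : ∀ N : Submodule R L, ∃ S : Finset (Ideal R), (∀ P ∈ S, P.IsPrime ∧ ¬ a ≤ P) ∧
      ∀ x ∈ a, (∀ P ∈ S, x ∉ P) →
      ∃ F : Submodule R L, F.FG ∧ N ≤ F ⊔ N.map (LinearMap.lsmul R L x) by
    obtain ⟨S, h₁, h₂⟩ := key ⊤
    refine ⟨S, h₁, fun x hx hxS => ?_⟩
    obtain ⟨F, hF, h⟩ := h₂ x hx hxS
    exact ⟨F, hF, top_le_iff.1 h⟩
  intro N
  induction N using IsArtinian.induction with
  | hgt N ih =>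
  by_cases hN : ∀ N₁ N₂ : Submodule R N, N₁ ⊔ N₂ = ⊤ → N₁ = ⊤ ∨ N₂ = ⊤
  · have sec := smul_top_eq_or_isNilpotent hN
    have hmap : ∀ x : R, (⊤ : Submodule R N).map (LinearMap.lsmul R N x) = ⊤ →
        N ≤ N.map (LinearMap.lsmul R L x) := by
      intro x hx z hz
      obtain ⟨w, -, hw⟩ : (⟨z, hz⟩ : N) ∈ (⊤ : Submodule R N).map (LinearMap.lsmul R N x) :=
        hx.ge trivial
      exact ⟨w, w.2, congrArg Subtype.val hw⟩
    let P : Ideal R := (Module.annihilator R N).radical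
    have hP : ∀ x, x ∈ P ↔ ∃ k : ℕ, ∀ z : N, x ^ k • z = 0 := fun x => by
      simp only [P, Ideal.mem_radical_iff, Module.mem_annihilator]
    -- If `a ≤ P`, a power of `a` kills `N`, so `N` is finitely generated. Otherwise `P` is prime
    -- and every `x ∉ P` acts surjectively on `N`.
    by_cases haP : a ≤ P
    · obtain ⟨t, ht⟩ := Ideal.exists_pow_le_of_le_radical_of_fg haP (IsNoetherian.noetherian a)
      have hle : N ≤ Submodule.torsionBySet R L ((a ^ t : Ideal R) : Set R) := fun z hz =>
        (Submodule.mem_torsionBySet_iff _ _).2 fun x =>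
          congrArg Subtype.val (Module.mem_annihilator.1 (ht x.2) ⟨z, hz⟩)
      have : IsNoetherian R (Submodule.torsionBySet R L ((a ^ t : Ideal R) : Set R)) :=
        isNoetherian_of_fg_of_noetherian _ (hfg t)
      have hNfg : N.FG := (isNoetherian_submodule.1 this) N hle
      exact ⟨∅, by simp, fun x _ _ => ⟨N, hNfg, le_sup_left⟩⟩
    · have hprime : P.IsPrime := by
        refine ⟨fun h => haP (h ▸ le_top), fun {x y} hxy => ?_⟩
        by_contra hcon
        push Not at hcon
        have hx := (sec x).resolve_right (fun h => hcon.1 ((hP x).2 h))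
        have hy := (sec y).resolve_right (fun h => hcon.2 ((hP y).2 h))
        obtain ⟨k, hk⟩ := (hP _).1 hxy
        have hsurj : ∀ r : R, (⊤ : Submodule R N).map (LinearMap.lsmul R N r) = ⊤ → ∀ j : ℕ,
            ∀ z : N, ∃ w : N, r ^ j • w = z := by
          intro r hr j
          induction j with
          | zero => exact fun z => ⟨z, by simp⟩
          | succ j ihj =>
            intro z
            obtain ⟨w, rfl⟩ := ihj z
            obtain ⟨v, -, rfl⟩ : w ∈ (⊤ : Submodule R N).map (LinearMap.lsmul R N r) :=
              hr.ge trivial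
            exact ⟨v, by rw [LinearMap.lsmul_apply, smul_smul, ← pow_succ]⟩
        refine hcon.1 ((hP x).2 ⟨k, fun z => ?_⟩)
        obtain ⟨w, rfl⟩ := hsurj y hy k z
        rw [smul_smul, ← mul_pow, hk]
      refine ⟨{P}, by simpa using ⟨hprime, haP⟩, fun x _ hx => ⟨⊥, Submodule.fg_bot, ?_⟩⟩
      refine (hmap x ((sec x).resolve_right fun h => hx P (by simp) ((hP x).2 h))).trans
        le_sup_right
  · push Not at hN
    obtain ⟨N₁, N₂, hsup, h₁, h₂⟩ := hN
    have hlt : ∀ K : Submodule R N, K ≠ ⊤ → K.map N.subtype < N := fun K hK => by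
      refine lt_of_le_of_ne (Submodule.map_subtype_le _ _) fun h => hK ?_
      refine Submodule.map_injective_of_injective N.subtype_injective ?_
      rw [h, Submodule.map_top, Submodule.range_subtype]
    have hN : N = N₁.map N.subtype ⊔ N₂.map N.subtype := by
      rw [← Submodule.map_sup, hsup, Submodule.map_top, Submodule.range_subtype]
    obtain ⟨S₁, hS₁, h₁⟩ := ih _ (hlt N₁ h₁)
    obtain ⟨S₂, hS₂, h₂⟩ := ih _ (hlt N₂ h₂)
    refine ⟨S₁ ∪ S₂, fun P hP => (Finset.mem_union.1 hP).elim (hS₁ P) (hS₂ P), fun x hx hxS => ?_⟩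
    obtain ⟨F₁, hF₁, h₁⟩ := h₁ x hx fun P hP => hxS P (Finset.mem_union_left _ hP)
    obtain ⟨F₂, hF₂, h₂⟩ := h₂ x hx fun P hP => hxS P (Finset.mem_union_right _ hP)
    refine ⟨F₁ ⊔ F₂, hF₁.sup hF₂, ?_⟩
    conv_lhs => rw [hN]
    refine sup_le (h₁.trans (sup_le_sup le_sup_left (Submodule.map_mono ?_)))
      (h₂.trans (sup_le_sup le_sup_right (Submodule.map_mono ?_)))
    · exact Submodule.map_subtype_le _ _
    · exact Submodule.map_subtype_le _ _

end Artinian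

/-! ### Supports and associated primes. -/

section Support

variable {L : Type*} [AddCommGroup L] [Module R L]

lemma exists_isAssociatedPrime_le [IsNoetherianRing R] {p : PrimeSpectrum R}
    (hp : p ∈ Module.support R L) :
    ∃ q : PrimeSpectrum R, IsAssociatedPrime q.asIdeal L ∧ q ≤ p := by
  obtain ⟨m, hm⟩ := Module.mem_support_iff_exists_annihilator.1 hp
  obtain ⟨q, hq, hqp⟩ := Ideal.exists_minimalPrimes_le hm
  have h := Module.associatedPrimes.minimalPrimes_annihilator_subset_associatedPrimes R
    (Submodule.span R {m}) hq
  exact ⟨⟨q, h.isPrime⟩, IsAssociatedPrime.map_of_injective (Submodule.span R {m}).subtype h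
    (Submodule.subtype_injective _), hqp⟩

lemma IsAssociatedPrime.mem_support [IsNoetherianRing R] {p : PrimeSpectrum R}
    (hp : IsAssociatedPrime p.asIdeal L) : p ∈ Module.support R L := by
  obtain ⟨-, m, hm⟩ := isAssociatedPrime_iff.1 hp
  refine Module.mem_support_iff'.2 ⟨m, fun r hr h => hr ?_⟩
  rw [hm]
  exact Submodule.mem_colon_singleton.2 h

/-- The associated primes of a torsion module are those of `(0 :_L a)`. -/
lemma finite_associatedPrimes [IsNoetherianRing R] {a : Ideal R} (h : ∀ z : L, z ∈ gamma a L)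
    [Module.Finite R (Submodule.torsionBySet R L (a : Set R))] :
    {p : PrimeSpectrum R | IsAssociatedPrime p.asIdeal L}.Finite := by
  have hfin := associatedPrimes.finite R (Submodule.torsionBySet R L (a : Set R))
  refine Set.Finite.of_finite_image (f := PrimeSpectrum.asIdeal) (hfin.subset ?_)
    (fun p _ q _ hpq => PrimeSpectrum.ext hpq)
  rintro _ ⟨p, hp, rfl⟩
  obtain ⟨hprime, m, hm⟩ := isAssociatedPrime_iff.1 hp
  obtain ⟨t, ht⟩ := h m
  have hap : a ≤ p.asIdeal := hprime.le_of_pow_le (n := t) fun x hx => by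
    rw [hm]
    exact Submodule.mem_colon_singleton.2 (ht x hx)
  have hmem : ∀ r, r ∈ p.asIdeal ↔ r • m = 0 := fun r => by
    rw [hm, Submodule.mem_colon_singleton, Submodule.mem_bot]
  refine isAssociatedPrime_iff.2 ⟨hprime,
    ⟨m, (Submodule.mem_torsionBySet_iff _ _).2 fun x => (hmem x).1 (hap x.2)⟩, ?_⟩
  ext r
  rw [hmem, Submodule.mem_colon_singleton, Submodule.mem_bot, Subtype.ext_iff]
  rfl

lemma notMem_support_smul {L : Type*} [AddCommGroup L] [Module R L] {c : Ideal R}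
    {N : Submodule R L} {p : PrimeSpectrum R}
    (h : ∀ x ∈ c, ∀ z ∈ N, ∃ r ∉ p.asIdeal, r • x • z = 0) :
    p ∉ Module.support R ↥(c • N) := by
  refine Module.notMem_support_iff'.2 ?_
  rintro ⟨w, hw⟩
  suffices ∃ r ∉ p.asIdeal, r • w = 0 by
    obtain ⟨r, hr, h0⟩ := this
    exact ⟨r, hr, Subtype.ext h0⟩
  refine Submodule.smul_induction_on hw h ?_
  rintro v w ⟨r, hr, hv⟩ ⟨s, hs, hw⟩
  refine ⟨r * s, p.isPrime.mul_notMem hr hs, ?_⟩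
  rw [smul_add, mul_smul, mul_smul, hw, smul_comm, hv, smul_zero, smul_zero, add_zero]

lemma mem_support_smul_top_iff (c : Ideal R) {p : PrimeSpectrum R} :
    p ∈ Module.support R ↥(c • (⊤ : Submodule R L)) ↔
      ∃ x ∈ c, ∃ z : L, ∀ r ∉ p.asIdeal, r • x • z ≠ 0 := by
  rw [← not_iff_not, Module.notMem_support_iff']
  push Not
  constructor
  · intro h x hx z
    obtain ⟨r, hr, hrz⟩ := h ⟨x • z, Submodule.smul_mem_smul hx trivial⟩
    exact ⟨r, hr, congrArg Subtype.val hrz⟩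
  · exact fun h => Module.notMem_support_iff'.1 (notMem_support_smul fun x hx z _ => h x hx z)

/-- If each `x m` with `x ∈ c` dies at `p`, one `r ∉ p` kills all of `c m`, so `r m ∈ (0 :_L c)`.
Dividing by `(0 :_L c)` thus removes the primes at which `c L` vanishes. -/
lemma mem_support_of_mem_support_quotient [IsNoetherianRing R] (c : Ideal R) {p : PrimeSpectrum R}
    (hp : p ∈ Module.support R (L ⧸ Submodule.torsionBySet R L (c : Set R))) :
    p ∈ Module.support R ↥(c • (⊤ : Submodule R L)) := by
  by_contra hcon
  rw [mem_support_smul_top_iff] at hcon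
  push Not at hcon
  obtain ⟨m, hm⟩ := Module.mem_support_iff'.1 hp
  obtain ⟨m, rfl⟩ := Submodule.Quotient.mk_surjective _ m
  obtain ⟨r, hr, h⟩ := exists_smul_eq_zero_of_fg p.asIdeal.primeCompl c
    (IsNoetherian.noetherian c) m (fun x hx => hcon x hx m)
  refine hm r hr ?_
  rw [← Submodule.Quotient.mk_smul, Submodule.Quotient.mk_eq_zero, Submodule.mem_torsionBySet_iff]
  exact fun x => by rw [smul_comm, h x x.2]

end Support

/-! ### Cofiniteness of torsion modules supported at maximal ideals. -/

section Cofinite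

variable {L : Type u} [AddCommGroup L] [Module R L]

/-- Scalars on `Ext` may be moved to the first variable, and `x` is zero on `R ⧸ a`. -/
lemma smul_extQuot_eq_zero {a : Ideal R} {k : ℕ} (ξ : extQuot a k L) {x : R} (hx : x ∈ a) :
    x • ξ = 0 := by
  have h : x • 𝟙 (ModuleCat.of R (R ⧸ a)) = 0 := by
    ext
    exact (Submodule.Quotient.mk_eq_zero _).2 (by simpa using hx)
  have h' : x • ξ = (x • Ext.mk₀ (𝟙 (ModuleCat.of R (R ⧸ a)))).comp ξ (zero_add k) := by
    rw [Ext.smul_comp, Ext.mk₀_id_comp]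
  rw [h', ← Ext.mk₀_smul, h, Ext.mk₀_zero, Ext.zero_comp]

/-- `Hom(R ⧸ a, L)` is `(0 :_L a)`. -/
noncomputable def extQuotZeroEquiv (a : Ideal R) (L : Type u) [AddCommGroup L] [Module R L] :
    extQuot a 0 L ≃ₗ[R] Submodule.torsionBySet R L (a : Set R) :=
  (Ext.linearEquiv₀.trans ModuleCat.homLinearEquiv).trans
    (LinearEquiv.ofBijective
      (((LinearMap.applyₗ (R := R) (1 : R ⧸ a)) : ((R ⧸ a) →ₗ[R] L) →ₗ[R] L).codRestrict
        (Submodule.torsionBySet R L (a : Set R)) fun f => by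
          rw [Submodule.mem_torsionBySet_iff]
          rintro ⟨x, hx⟩
          exact smul_apply_eq_zero (L := ModuleCat.of R L) (ModuleCat.ofHom f) 1 x hx)
      ⟨fun f g h => by
        have h' := congrArg Subtype.val h
        ext
        exact h', fun z => by
        refine ⟨a.liftQ (LinearMap.toSpanSingleton R L z) fun x hx => ?_, Subtype.ext ?_⟩
        · exact (Submodule.mem_torsionBySet_iff _ _).1 z.2 ⟨x, hx⟩
        · exact one_smul R z.1⟩)

lemma finite_extQuot_zero_iff {a : Ideal R} :
    Module.Finite R (extQuot a 0 L) ↔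
      Module.Finite R (Submodule.torsionBySet R L (a : Set R)) :=
  ⟨fun _ => Module.Finite.equiv (extQuotZeroEquiv a L),
    fun _ => Module.Finite.equiv (extQuotZeroEquiv a L).symm⟩

/-- Multiplication by `x` factors as `L → x L → L` and is zero on `Ext(R ⧸ a, L)`. So the image of
`Ext^k(L)` in `Ext^k(x L)` lies in the image of the connecting map from `Ext^{k-1}(L ⧸ x L)`, and
the kernel is controlled by `(0 :_L x)`. -/
lemma IsExactClosed.ext_of_torsionBy {P : ModuleCat.{u} R → Prop} (hP : IsExactClosed P)
    {a : Ideal R} {x : R} (hx : x ∈ a) (k : ℕ) (hK : P (extQuot a k (Submodule.torsionBy R L x)))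
    (hQ : ∀ j, k = j + 1 → P (extQuot a j (L ⧸ LinearMap.range (LinearMap.lsmul R L x)))) :
    P (extQuot a k L) := by
  let f : L →ₗ[R] L := LinearMap.lsmul R L x
  have hS := shortExact_of_linearMap (Submodule.subtype_injective (LinearMap.ker f))
    (g := f.rangeRestrict) (by
      have := LinearMap.exact_subtype_ker_map f.rangeRestrict
      rw [LinearMap.exact_iff] at this ⊢
      rw [this, LinearMap.ker_rangeRestrict, Submodule.range_subtype]) f.surjective_rangeRestrict
  let α : extQuot a k L →ₗ[R] extQuot a k (LinearMap.range f) :=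
    (Ext.mk₀ (ModuleCat.ofHom f.rangeRestrict)).postcompOfLinear R (ModuleCat.of R (R ⧸ a))
      (add_zero k)
  let β : extQuot a k (LinearMap.range f) →ₗ[R] extQuot a k L :=
    (Ext.mk₀ (ModuleCat.ofHom (LinearMap.range f).subtype)).postcompOfLinear R
      (ModuleCat.of R (R ⧸ a)) (add_zero k)
  have hβα : ∀ ξ, β (α ξ) = 0 := fun ξ => by
    have h₁ : β (α ξ) = ξ.comp (Ext.mk₀ (ModuleCat.ofHom f.rangeRestrict ≫
        ModuleCat.ofHom (LinearMap.range f).subtype)) (add_zero k) := by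
      change (Ext.comp ξ _ (add_zero k)).comp _ (add_zero k) = _
      rw [Ext.comp_assoc_of_third_deg_zero, Ext.mk₀_comp_mk₀]
    have h₂ : ModuleCat.ofHom f.rangeRestrict ≫ ModuleCat.ofHom (LinearMap.range f).subtype =
        x • 𝟙 (ModuleCat.of R L) := by
      ext
      rfl
    rw [h₁, h₂, ← Ext.smul_eq_comp_mk₀, smul_extQuot_eq_zero ξ hx]
  have hrange : P (ModuleCat.of R (LinearMap.range α)) := by
    cases k with
    | zero =>
      have hmono : Mono (ModuleCat.ofHom (LinearMap.range f).subtype) :=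
        (ModuleCat.mono_iff_injective _).2 (Submodule.subtype_injective _)
      have hβ : Function.Injective β := Ext.postcomp_mk₀_injective_of_mono _ _
      refine hP.of_subsingleton _ ⟨?_⟩
      rintro ⟨_, ξ, rfl⟩ ⟨_, η, rfl⟩
      exact Subtype.ext (hβ ((hβα ξ).trans (hβα η).symm))
    | succ j =>
      have hS' := shortExact_of_linearMap (Submodule.subtype_injective (LinearMap.range f))
        (LinearMap.exact_iff.2 (by simp)) (Submodule.mkQ_surjective (LinearMap.range f))
      let δ : extQuot a j (L ⧸ LinearMap.range f) →ₗ[R] extQuot a (j + 1) (LinearMap.range f) :=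
        hS'.extClass.postcompOfLinear R (ModuleCat.of R (R ⧸ a)) rfl
      have hδ : P (ModuleCat.of R (LinearMap.range δ)) :=
        hP.of_surjective (A := extQuot a j (L ⧸ LinearMap.range f)) δ.rangeRestrict
          δ.surjective_rangeRestrict (hQ j rfl)
      have hle : LinearMap.range α ≤ LinearMap.range δ := by
        rintro _ ⟨ξ, rfl⟩
        exact Ext.covariant_sequence_exact₁ _ hS' _ (hβα ξ) rfl
      exact hP.of_injective (A := ModuleCat.of R (LinearMap.range α))
        (B := ModuleCat.of R (LinearMap.range δ)) (Submodule.inclusion hle)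
        (Submodule.inclusion_injective hle) hδ
  refine hP.of_exact (C := ModuleCat.of R (LinearMap.range α))
    ((Ext.mk₀ (ModuleCat.ofHom (LinearMap.ker f).subtype)).postcompOfLinear R
      (ModuleCat.of R (R ⧸ a)) (add_zero k)) α.rangeRestrict (fun ξ hξ => ?_) hK hrange
  exact Ext.covariant_sequence_exact₂ _ hS ξ (congrArg Subtype.val hξ)

variable [IsNoetherianRing R]

/-- Multiplication by generators of `a` maps `(0 :_L a ^ (t + 1))` into a finite power of `(0 :_L a
^ t)`, with kernel `(0 :_L a)`. -/
lemma finite_torsionBySet_pow {a : Ideal R}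
    [Module.Finite R (Submodule.torsionBySet R L (a : Set R))] (t : ℕ) :
    Module.Finite R (Submodule.torsionBySet R L ((a ^ t : Ideal R) : Set R)) := by
  induction t with
  | zero =>
    have : Submodule.torsionBySet R L ((a ^ 0 : Ideal R) : Set R) = ⊥ := by
      rw [pow_zero, Ideal.one_eq_top]
      exact Submodule.torsionBySet_univ
    rw [this]
    infer_instance
  | succ t ih =>
    obtain ⟨s, hs⟩ := IsNoetherian.noetherian a
    have hsa : ∀ x ∈ s, x ∈ a := fun x hx => hs ▸ Submodule.subset_span hx
    let f : Submodule.torsionBySet R L (a : Set R) →ₗ[R]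
        Submodule.torsionBySet R L ((a ^ (t + 1) : Ideal R) : Set R) :=
      Submodule.inclusion (Submodule.torsionBySet_le_torsionBySet_of_subset
        (Ideal.pow_le_self (Nat.succ_ne_zero t)))
    let g : Submodule.torsionBySet R L ((a ^ (t + 1) : Ideal R) : Set R) →ₗ[R]
        (s → Submodule.torsionBySet R L ((a ^ t : Ideal R) : Set R)) :=
      LinearMap.pi fun x => LinearMap.codRestrict _ ((LinearMap.lsmul R L (x : R)) ∘ₗ
        Submodule.subtype _) fun z => by
          rw [Submodule.mem_torsionBySet_iff]
          rintro ⟨y, hy⟩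
          change y • (x : R) • (z : L) = 0
          rw [smul_smul]
          exact (Submodule.mem_torsionBySet_iff _ _).1 z.2
            ⟨_, pow_succ a t ▸ Ideal.mul_mem_mul hy (hsa x x.2)⟩
    refine isExactClosed_finite.of_exact (A := ModuleCat.of R _)
      (B := ModuleCat.of R (Submodule.torsionBySet R L ((a ^ (t + 1) : Ideal R) : Set R)))
      (C := ModuleCat.of R (s → Submodule.torsionBySet R L ((a ^ t : Ideal R) : Set R))) f g ?_
      ‹_› (Module.Finite.pi)
    intro z hz
    refine ⟨⟨z.1, ?_⟩, rfl⟩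
    have : z.1 ∈ Submodule.torsionBySet R L (s : Set R) := by
      rw [Submodule.mem_torsionBySet_iff]
      intro x
      exact congrArg Subtype.val (congrFun hz x)
    rw [Submodule.torsionBySet_eq_torsionBySet_span] at this
    exact (congrArg (fun I : Ideal R => Submodule.torsionBySet R L (I : Set R)) hs).le this

omit [IsNoetherianRing R] in
-- Prime avoidance, which tolerates the one possibly non-prime ideal `J`.
lemma exists_mem_notMem {a J : Ideal R} (hJ : ¬ a ≤ J) (S : Finset (Ideal R))
    (hS : ∀ P ∈ S, P.IsPrime ∧ ¬ a ≤ P) : ∃ x ∈ a, x ∉ J ∧ ∀ P ∈ S, x ∉ P := by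
  classical
  by_contra hcon
  push Not at hcon
  have hsub : (a : Set R) ⊆ ⋃ P ∈ ((insert J S : Finset (Ideal R)) : Set (Ideal R)), (P : Set R) := by
    intro x hx
    by_cases h : x ∈ J
    · exact Set.mem_biUnion (Finset.mem_coe.2 (Finset.mem_insert_self J S)) h
    · obtain ⟨P, hP, hxP⟩ := hcon x hx h
      exact Set.mem_biUnion (Finset.mem_coe.2 (Finset.mem_insert_of_mem hP)) hxP
  obtain ⟨P, hP, haP⟩ := (Ideal.subset_union_prime (f := id) J J (fun P hP h _ =>
    (hS P ((Finset.mem_insert.1 hP).resolve_left h)).1)).1 hsub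
  rcases Finset.mem_insert.1 hP with rfl | hP
  · exact hJ haP
  · exact (hS P hP).2 haP

omit [IsNoetherianRing R] in
lemma finite_quotient_of_sup_eq_top {F N : Submodule R L} (hF : F.FG) (h : F ⊔ N = ⊤) :
    Module.Finite R (L ⧸ N) := by
  have : Module.Finite R F := Module.Finite.iff_fg.2 hF
  refine Module.Finite.of_surjective (N.mkQ ∘ₗ F.subtype) fun z => ?_
  obtain ⟨z, rfl⟩ := Submodule.Quotient.mk_surjective _ z
  obtain ⟨f, hf, n, hn, rfl⟩ := Submodule.mem_sup.1 (h.ge trivial : z ∈ F ⊔ N)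
  exact ⟨⟨f, hf⟩, by simpa using hn⟩

lemma finite_torsionBySet_of_injective {a : Ideal R} {K : Type u} [AddCommGroup K] [Module R K]
    {f : K →ₗ[R] L} (hf : Function.Injective f)
    [h : Module.Finite R (Submodule.torsionBySet R L (a : Set R))] :
    Module.Finite R (Submodule.torsionBySet R K (a : Set R)) :=
  finite_extQuot_zero_iff.1
    (isExactClosed_finite.ext_zero_of_injective hf (finite_extQuot_zero_iff.2 h))

omit [IsNoetherianRing R] in
lemma finite_of_forall_smul_eq_zero {a : Ideal R}
    [h : Module.Finite R (Submodule.torsionBySet R L (a : Set R))]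
    (ha : ∀ x ∈ a, ∀ z : L, x • z = 0) : Module.Finite R L := by
  have : Submodule.torsionBySet R L (a : Set R) = ⊤ :=
    eq_top_iff.2 fun z _ => (Submodule.mem_torsionBySet_iff _ _).2 fun x => ha x x.2 z
  rw [this] at h
  exact Module.Finite.equiv Submodule.topEquiv

omit [IsNoetherianRing R] in
lemma mem_gamma_of_injective {a : Ideal R} {K : Type*} [AddCommGroup K] [Module R K]
    {f : K →ₗ[R] L} (hf : Function.Injective f) (h : ∀ z : L, z ∈ gamma a L) (z : K) :
    z ∈ gamma a K := by
  obtain ⟨t, ht⟩ := h (f z)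
  exact ⟨t, fun x hx => hf (by rw [map_smul, ht x hx, map_zero])⟩

omit [IsNoetherianRing R] in
lemma mem_gamma_of_surjective {a : Ideal R} {K : Type*} [AddCommGroup K] [Module R K]
    {f : L →ₗ[R] K} (hf : Function.Surjective f) (h : ∀ z : L, z ∈ gamma a L) (z : K) :
    z ∈ gamma a K := by
  obtain ⟨z, rfl⟩ := hf z
  obtain ⟨t, ht⟩ := h z
  exact ⟨t, fun x hx => by rw [← map_smul, ht x hx, map_zero]⟩

omit [IsNoetherianRing R] in
lemma sup_span_smul_eq_zero {J : Ideal R} (hJ : ∀ y ∈ J, ∀ z : L, y • z = 0) (x : R) :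
    ∀ y ∈ J ⊔ Ideal.span {x}, ∀ z : Submodule.torsionBy R L x, y • z = 0 := by
  intro y hy z
  obtain ⟨j, hj, w, hw, rfl⟩ := Submodule.mem_sup.1 hy
  obtain ⟨r, rfl⟩ := Ideal.mem_span_singleton'.1 hw
  rw [add_smul, mul_smul, Submodule.smul_torsionBy, smul_zero, add_zero]
  exact Subtype.ext (hJ j hj z)

omit [IsNoetherianRing R] in
lemma lt_sup_span {J : Ideal R} {x : R} (hx : x ∉ J) : J < J ⊔ Ideal.span {x} :=
  lt_of_le_of_ne le_sup_left fun h => hx (h ▸ Ideal.mem_sup_right (Ideal.mem_span_singleton_self x))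

/-- A torsion module supported at maximal ideals is cofinite if `(0 :_L a)` is finitely
generated. -/
theorem finite_extQuot_of_support_isMaximal {a : Ideal R} (htor : ∀ z : L, z ∈ gamma a L)
    (hsupp : ∀ p ∈ Module.support R L, p.asIdeal.IsMaximal)
    [hfin : Module.Finite R (Submodule.torsionBySet R L (a : Set R))] (k : ℕ) :
    Module.Finite R (extQuot a k L) := by
  -- Noetherian induction on an ideal `J` killing `L`: for `x ∉ J` the submodule `(0 :_L x)` is
  -- killed by the larger ideal `J + (x)`. It ends when `a ≤ J`, where `L = (0 :_L a)` is finitely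
  -- generated.
  suffices key : ∀ J : Ideal R, ∀ (L : Type u) [AddCommGroup L] [Module R L]
      (_ : ∀ z : L, z ∈ gamma a L) (_ : ∀ p ∈ Module.support R L, p.asIdeal.IsMaximal)
      (_ : Module.Finite R (Submodule.torsionBySet R L (a : Set R)))
      (_ : ∀ y ∈ J, ∀ z : L, y • z = 0) (k : ℕ), Module.Finite R (extQuot a k L) from
    key ⊥ L htor hsupp hfin (fun y hy z => by rw [(Submodule.mem_bot R).1 hy, zero_smul]) k
  clear! L
  intro J
  induction J using WellFoundedGT.induction with
  | ind J ih =>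
  intro L _ _ htor hsupp hfin hJ k
  by_cases haJ : a ≤ J
  · have := finite_of_forall_smul_eq_zero (a := a) (fun x hx z => hJ x (haJ hx) z)
    infer_instance
  have : IsArtinian R (Submodule.torsionBySet R L (a : Set R)) :=
    isArtinian_of_support fun p hp => hsupp p
      (Module.support_subset_of_injective _ (Submodule.subtype_injective _) hp)
  have := isArtinian_of_torsionBySet htor
  obtain ⟨S, hS, hx⟩ := exists_primes_of_isArtinian (L := L) a fun t =>
    Module.Finite.iff_fg.1 (finite_torsionBySet_pow t)
  -- For this `x` the quotient `L ⧸ x L` is finitely generated and the induction applies to `(0 :_L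
  -- x)`.
  obtain ⟨x, hxa, hxJ, hxS⟩ := exists_mem_notMem haJ S hS
  obtain ⟨F, hF, hFx⟩ := hx x hxa hxS
  rw [Submodule.map_top] at hFx
  have := finite_quotient_of_sup_eq_top hF hFx
  have hinj := Submodule.subtype_injective (Submodule.torsionBy R L x)
  refine isExactClosed_finite.ext_of_torsionBy hxa k ?_ fun j _ => ?_
  · exact ih _ (lt_sup_span hxJ) _ (mem_gamma_of_injective hinj htor)
      (fun p hp => hsupp p (Module.support_subset_of_injective _ hinj hp))
      (finite_torsionBySet_of_injective hinj) (sup_span_smul_eq_zero hJ x) k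
  · change Module.Finite R (extQuot a j _)
    infer_instance

end Cofinite

/-! ### General elements at a minimal prime of the support. -/

section Localized

variable {L : Type u} [AddCommGroup L] [Module R L] (S : Submonoid R)

lemma comap_mem_support_of_localized (Q : PrimeSpectrum (Localization S))
    (hQ : Q ∈ Module.support (Localization S) (LocalizedModule S L)) :
    PrimeSpectrum.comap (algebraMap R (Localization S)) Q ∈ Module.support R L := by
  obtain ⟨z, hz⟩ := Module.mem_support_iff'.1 hQ
  induction z with | _ m s
  refine Module.mem_support_iff'.2 ⟨m, fun r hr h => hz (algebraMap R _ r) hr ?_⟩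
  rw [algebraMap_smul, LocalizedModule.smul'_mk, h, LocalizedModule.zero_mk]

omit S in
lemma isMaximal_of_comap_eq {p : PrimeSpectrum R}
    (Q : PrimeSpectrum (Localization.AtPrime p.asIdeal))
    (h : PrimeSpectrum.comap (algebraMap R (Localization.AtPrime p.asIdeal)) Q = p) :
    Q.asIdeal.IsMaximal := by
  have h' : PrimeSpectrum.comap (algebraMap R (Localization.AtPrime p.asIdeal))
      (IsLocalRing.closedPoint (Localization.AtPrime p.asIdeal)) = p :=
    PrimeSpectrum.ext (IsLocalization.AtPrime.under_maximalIdeal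
      (Localization.AtPrime p.asIdeal) p.asIdeal)
  rw [PrimeSpectrum.localization_comap_injective _ p.asIdeal.primeCompl (h.trans h'.symm)]
  exact IsLocalRing.maximalIdeal.isMaximal _

variable [IsNoetherianRing R]

lemma torsionBySet_localized (c : Ideal R) :
    Submodule.torsionBySet (Localization S) (LocalizedModule S L)
        (c.map (algebraMap R (Localization S)) : Set (Localization S)) =
      LinearMap.range (LocalizedModule.map S (Submodule.torsionBySet R L (c : Set R)).subtype) := by
  ext z
  have h : z ∈ Submodule.torsionBySet (Localization S) (LocalizedModule S L)
        (c.map (algebraMap R (Localization S)) : Set (Localization S)) ↔ ∀ x ∈ c, x • z = 0 := by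
    rw [Submodule.mem_torsionBySet_iff, ← forall_mem_map_smul_eq_zero]
    simp
  rw [h]
  constructor
  · intro h
    induction z with | _ m s
    simp only [smul_mk_eq_zero_iff] at h
    obtain ⟨u, hu, h⟩ := exists_smul_eq_zero_of_fg S _ (IsNoetherian.noetherian c) m h
    refine ⟨LocalizedModule.mk ⟨u • m, ?_⟩ (⟨u, hu⟩ * s), ?_⟩
    · exact (Submodule.mem_torsionBySet_iff _ _).2 fun x => by rw [smul_comm, h x x.2]
    · rw [LocalizedModule.map_mk]
      exact LocalizedModule.mk_cancel_common_left ⟨u, hu⟩ s m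
  · rintro ⟨w, rfl⟩ x hx
    induction w with | _ m s
    rw [LocalizedModule.map_mk, LocalizedModule.smul'_mk]
    have : x • (m : L) = 0 := (Submodule.mem_torsionBySet_iff _ _).1 m.2 ⟨x, hx⟩
    rw [Submodule.subtype_apply, this, LocalizedModule.zero_mk]

lemma finite_torsionBySet_localized {c : Ideal R}
    [Module.Finite R (Submodule.torsionBySet R L (c : Set R))] :
    Module.Finite (Localization S) (Submodule.torsionBySet (Localization S) (LocalizedModule S L)
        (c.map (algebraMap R (Localization S)) : Set (Localization S))) := by
  rw [torsionBySet_localized]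
  have : Module.Finite (Localization S)
      (LocalizedModule S (Submodule.torsionBySet R L (c : Set R))) :=
    Module.Finite.of_isLocalizedModule S (Rₚ := Localization S)
      (LocalizedModule.mkLinearMap S (Submodule.torsionBySet R L (c : Set R)))
  infer_instance

lemma mem_gamma_localized {a : Ideal R} (h : ∀ z : L, z ∈ gamma a L) (z : LocalizedModule S L) :
    z ∈ gamma (a.map (algebraMap R (Localization S))) (LocalizedModule S L) := by
  induction z with | _ m s
  exact (mem_gamma_localized_iff S a _).2 ⟨m, h m, s, rfl⟩

/-- Let `p` be a prime ideal such that `p` is the only prime ideal in the support of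
`L` which is contained in `p`. Then, for a general element `x` of `a`, the localization of
`L / x L` at `p` is killed by a power of `a`. -/
lemma exists_primes_local {a : Ideal R} (htor : ∀ z : L, z ∈ gamma a L)
    [Module.Finite R (Submodule.torsionBySet R L (a : Set R))] (p : PrimeSpectrum R)
    (hp : ∀ q ∈ Module.support R L, q ≤ p → q = p) :
    ∃ S : Finset (Ideal R), (∀ P ∈ S, P.IsPrime ∧ ¬ a ≤ P) ∧ ∀ x ∈ a, (∀ P ∈ S, x ∉ P) →
      ∃ t : ℕ, ∀ y ∈ a ^ t, ∀ z : L, ∃ r ∉ p.asIdeal,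
        r • y • z ∈ LinearMap.range (LinearMap.lsmul R L x) := by
  classical
  let U := p.asIdeal.primeCompl
  let A := Localization.AtPrime p.asIdeal
  let c : Ideal A := a.map (algebraMap R A)
  have htor' : ∀ z : LocalizedModule U L, z ∈ gamma c (LocalizedModule U L) :=
    mem_gamma_localized U htor
  have hfin : Module.Finite A (Submodule.torsionBySet A (LocalizedModule U L) (c : Set A)) :=
    finite_torsionBySet_localized U
  have hnoeth : IsNoetherianRing A := IsLocalization.isNoetherianRing U A inferInstance
  -- By minimality of `p`, the localized module is supported only at the maximal ideal, so its
  -- `a`-torsion part is artinian, and then so is the whole module.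
  have : IsArtinian A (Submodule.torsionBySet A (LocalizedModule U L) (c : Set A)) := by
    refine isArtinian_of_support fun Q hQ => ?_
    have hQ' := comap_mem_support_of_localized U Q
      (Module.support_subset_of_injective _ (Submodule.subtype_injective _) hQ)
    have hle : PrimeSpectrum.comap (algebraMap R A) Q ≤ p := by
      intro r hr
      by_contra hrp
      exact Q.isPrime.ne_top (Ideal.eq_top_of_isUnit_mem _ hr
        (IsLocalization.map_units A (⟨r, hrp⟩ : U)))
    exact isMaximal_of_comap_eq Q (hp _ hQ' hle)
  have := isArtinian_of_torsionBySet htor'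
  obtain ⟨S, hS, hx⟩ := exists_primes_of_isArtinian (L := LocalizedModule U L) c fun t =>
    Module.Finite.iff_fg.1 (finite_torsionBySet_pow t)
  refine ⟨S.image fun P => P.comap (algebraMap R A), ?_, fun x hxa hxS => ?_⟩
  · intro P hP
    obtain ⟨P, hPS, rfl⟩ := Finset.mem_image.1 hP
    have := (hS P hPS).1
    exact ⟨inferInstance, fun h => (hS P hPS).2 (Ideal.map_le_iff_le_comap.2 h)⟩
  · obtain ⟨F, hF, hFx⟩ := hx (algebraMap R A x) (Ideal.mem_map_of_mem _ hxa)
      fun P hP hxP => hxS _ (Finset.mem_image_of_mem _ hP) hxP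
    -- With `L_p = F + x L_p` and `a ^ t F = 0` one gets `a ^ t L_p ⊆ x L_p`.
    obtain ⟨t, ht⟩ := exists_pow_smul_eq_zero_of_fg F hF fun z _ => htor' z
    refine ⟨t, fun y hy z => ?_⟩
    obtain ⟨f, hf, _, ⟨w, -, rfl⟩, hfw⟩ := Submodule.mem_sup.1
      (hFx.ge trivial : LocalizedModule.mk z (1 : U) ∈ _)
    have hy' : algebraMap R A y ∈ c ^ t := by
      rw [← Ideal.map_pow]
      exact Ideal.mem_map_of_mem _ hy
    have h₁ : y • LocalizedModule.mk z (1 : U) = y • x • w := by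
      rw [← hfw, smul_add, ← algebraMap_smul A y f, ht _ hy' f hf, zero_add, LinearMap.lsmul_apply,
        algebraMap_smul]
    induction w with | _ w s
    rw [LocalizedModule.smul'_mk, LocalizedModule.smul'_mk, LocalizedModule.smul'_mk,
      LocalizedModule.mk_eq] at h₁
    obtain ⟨u, hu⟩ := h₁
    refine ⟨u * s, p.isPrime.mul_notMem u.2 s.2, (u : R) • y • w, ?_⟩
    simp only [Submonoid.smul_def, one_smul] at hu
    rw [LinearMap.lsmul_apply, mul_smul, hu, smul_comm x (u : R), smul_comm x y]

end Localized

/-! ### Cofiniteness of torsion modules with one-dimensional support. -/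

section Cofinite

variable [IsNoetherianRing R]

/-- A torsion module `L` with one-dimensional support is cofinite if `Hom(R ⧸ a, L)` and
`Ext¹(R ⧸ a, L)` are finitely generated. -/
theorem finite_extQuot_of_support {L : Type u} [AddCommGroup L] [Module R L] {a : Ideal R}
    (htor : ∀ z : L, z ∈ gamma a L)
    (hsupp : ∀ p ∈ Module.support R L, ∀ q, p < q → q.asIdeal.IsMaximal)
    (h₀ : Module.Finite R (extQuot a 0 L)) (h₁ : Module.Finite R (extQuot a 1 L)) (k : ℕ) :
    Module.Finite R (extQuot a k L) := by
  suffices key : ∀ J : Ideal R, ∀ (L : Type u) [AddCommGroup L] [Module R L]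
      (_ : ∀ z : L, z ∈ gamma a L)
      (_ : ∀ p ∈ Module.support R L, ∀ q, p < q → q.asIdeal.IsMaximal)
      (_ : Module.Finite R (extQuot a 0 L)) (_ : Module.Finite R (extQuot a 1 L))
      (_ : ∀ y ∈ J, ∀ z : L, y • z = 0) (k : ℕ), Module.Finite R (extQuot a k L) from
    key ⊥ L htor hsupp h₀ h₁ (fun y hy z => by rw [(Submodule.mem_bot R).1 hy, zero_smul]) k
  clear! L
  intro J
  induction J using WellFoundedGT.induction with
  | ind J ih =>
  intro L _ _ htor hsupp h₀ h₁ hJ k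
  have hfin := finite_extQuot_zero_iff.1 h₀
  by_cases haJ : a ≤ J
  · have := finite_of_forall_smul_eq_zero (a := a) (fun x hx z => hJ x (haJ hx) z)
    infer_instance
  have hP := isExactClosed_finite (R := R)
  -- Non-maximal primes of the support are minimal in it, hence associated, hence finitely many. So
  -- one `x` can be general at all of them.
  let T : Set (PrimeSpectrum R) := {p | p ∈ Module.support R L ∧ ¬ p.asIdeal.IsMaximal}
  have hTle : ∀ p ∈ T, ∀ q ∈ Module.support R L, q ≤ p → q = p := fun p hp q hq hqp => by
    by_contra hne
    exact hp.2 (hsupp q hq p (lt_of_le_of_ne hqp hne))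
  have hT : T.Finite := (finite_associatedPrimes htor).subset fun p hp => by
    obtain ⟨q, hq, hqp⟩ := exists_isAssociatedPrime_le hp.1
    rw [← hTle p hp q (IsAssociatedPrime.mem_support hq) hqp]
    exact hq
  choose! S hS hx using fun p (hp : p ∈ T) => exists_primes_local htor p (hTle p hp)
  classical
  obtain ⟨x, hxa, hxJ, hxS⟩ := exists_mem_notMem haJ (hT.toFinset.biUnion S) (fun P hP => by
    obtain ⟨p, hp, hPp⟩ := Finset.mem_biUnion.1 hP
    exact hS p (hT.mem_toFinset.1 hp) P hPp)
  have hx' : ∀ p ∈ T, ∃ t : ℕ, ∀ y ∈ a ^ t, ∀ z : L, ∃ r ∉ p.asIdeal,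
      r • y • z ∈ LinearMap.range (LinearMap.lsmul R L x) := fun p hp =>
    hx p hp x hxa fun P hP => hxS P (Finset.mem_biUnion.2 ⟨p, hT.mem_toFinset.2 hp, hP⟩)
  choose! t ht using hx'
  let N := LinearMap.range (LinearMap.lsmul R L x)
  let t₀ := hT.toFinset.sup t
  have hinj := Submodule.subtype_injective (Submodule.torsionBy R L x)
  have hsurj := Submodule.mkQ_surjective N
  have hker : Function.Exact (Submodule.torsionBy R L x).subtype
      (LinearMap.lsmul R L x).rangeRestrict := by
    rw [LinearMap.exact_iff, LinearMap.ker_rangeRestrict, Submodule.range_subtype]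
    rfl
  have hN₀ : Module.Finite R (extQuot a 0 N) :=
    hP.ext_zero_of_injective (Submodule.subtype_injective N) h₀
  have hK : ∀ k, Module.Finite R (extQuot a k (Submodule.torsionBy R L x)) :=
    ih _ (lt_sup_span hxJ) _ (mem_gamma_of_injective hinj htor)
      (fun p hp => hsupp p (Module.support_subset_of_injective _ hinj hp))
      (hP.ext_zero_of_injective hinj h₀)
      (hP.ext_left hinj hker (LinearMap.surjective_rangeRestrict _) 0 hN₀ h₁)
      (sup_span_smul_eq_zero hJ x)
  -- Cofiniteness of `(0 :_L x)` in degree `2` gives `Ext¹` of `x L`, which in turn gives `Hom(R ⧸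
  -- a, L ⧸ x L)`.
  have hN₁ : Module.Finite R (extQuot a 1 N) :=
    hP.ext_right hinj hker (LinearMap.surjective_rangeRestrict _) 1 h₁ (hK 2)
  have hQ₀ : Module.Finite R (extQuot a 0 (L ⧸ N)) :=
    hP.ext_right (Submodule.subtype_injective N) (LinearMap.exact_iff.2 (by simp)) hsurj 0 h₀ hN₁
  have hQfin := finite_extQuot_zero_iff.1 hQ₀
  -- `W` is finitely generated, and `a ^ t₀` kills `L ⧸ x L` at every prime of `T`, so the quotient
  -- by `W` is supported at maximal ideals only.
  let W := Submodule.torsionBySet R (L ⧸ N) ((a ^ t₀ : Ideal R) : Set R)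
  have hW : Module.Finite R W := finite_torsionBySet_pow t₀
  have hQtor := mem_gamma_of_surjective hsurj htor
  have hWsurj := Submodule.mkQ_surjective W
  have hWexact : Function.Exact W.subtype W.mkQ := LinearMap.exact_iff.2 (by simp)
  have hQW₀ : Module.Finite R (extQuot a 0 ((L ⧸ N) ⧸ W)) :=
    hP.ext_right (Submodule.subtype_injective W) hWexact hWsurj 0 hQ₀
      (show Module.Finite R (extQuot a 1 W) by infer_instance)
  have hQW : ∀ k, Module.Finite R (extQuot a k ((L ⧸ N) ⧸ W)) := by
    have := finite_extQuot_zero_iff.1 hQW₀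
    refine finite_extQuot_of_support_isMaximal (mem_gamma_of_surjective hWsurj hQtor) ?_
    intro p hp
    by_contra hpm
    have hpT : p ∈ T := ⟨Module.support_subset_of_surjective _ hsurj
      (Module.support_subset_of_surjective _ hWsurj hp), hpm⟩
    obtain ⟨y, hy, z, hz⟩ := (mem_support_smul_top_iff _).1
      (mem_support_of_mem_support_quotient _ hp)
    obtain ⟨z, rfl⟩ := hsurj z
    have hle : t p ≤ t₀ := Finset.le_sup (f := t) (hT.mem_toFinset.2 hpT)
    obtain ⟨r, hr, h⟩ := ht p hpT y (Ideal.pow_le_pow_right hle hy) z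
    refine hz r hr ?_
    rw [← map_smul, ← map_smul]
    exact (Submodule.Quotient.mk_eq_zero N).2 h
  have hQ : ∀ k, Module.Finite R (extQuot a k (L ⧸ N)) := fun k =>
    hP.ext_middle (Submodule.subtype_injective W) hWexact hWsurj k
      (show Module.Finite R (extQuot a k W) by infer_instance) (hQW k)
  exact hP.ext_of_torsionBy hxa k (hK k) fun j _ => hQ j

end Cofinite

/-! ### Infima of sets of degrees. -/

section Invariants

/-- The clause `r ≠ ⊤` is needed because the empty infimum `⊤` does not exceed itself. -/
lemma lt_iInf_natCast_iff {Q : ℕ → Prop} {r : ℕ∞} :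
    r < ⨅ (i : ℕ) (_ : Q i), (i : ℕ∞) ↔ r ≠ ⊤ ∧ ∀ i : ℕ, (i : ℕ∞) ≤ r → ¬ Q i := by
  induction r with
  | top => simp
  | coe n =>
    rw [← ENat.add_one_le_iff (ENat.natCast_ne_top n), le_iInf₂_iff]
    refine ⟨fun h => ⟨ENat.natCast_ne_top n, fun i hi hQ => ?_⟩, fun h i hQ => ?_⟩
    · have := h i hQ
      norm_cast at this hi
      omega
    · have := mt (h.2 i) (not_not.2 hQ)
      norm_cast at this ⊢
      omega

lemma le_iInf_natCast_iff {Q : ℕ → Prop} {r : ℕ∞} :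
    r ≤ ⨅ (i : ℕ) (_ : Q i), (i : ℕ∞) ↔ ∀ i : ℕ, (i : ℕ∞) < r → ¬ Q i := by
  rw [le_iInf₂_iff]
  exact ⟨fun h i hi hQ => absurd (h i hQ) (not_le.2 hi), fun h i hQ =>
    not_lt.1 fun hi => h i hi hQ⟩

end Invariants

/-! ### Cofiniteness below `f^2_a(M)`, finiteness of associated primes, and comparison of the
bounds. -/

section LocalCohomology

lemma injective_of_subsingleton (M : Type u) [AddCommGroup M] [Module R M] [Subsingleton M] :
    Module.Injective R M :=
  ⟨fun _ _ _ _ _ _ _ _ _ => ⟨0, fun _ => Subsingleton.elim _ _⟩⟩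

/-- A zero module is injective, so `0 → M → M → 0 → 0` serves for dimension shifting. -/
lemma subsingleton_H_of_subsingleton (a : Ideal R) (i : ℕ) (M : Type u) [AddCommGroup M]
    [Module R M] [Subsingleton M] : Subsingleton (H a i M) := by
  induction i using Nat.strong_induction_on generalizing M with
  | _ i ih =>
  have := injective_of_subsingleton (R := R) M
  have hf : Function.Injective (LinearMap.id : M →ₗ[R] M) := fun _ _ h => h
  have hg : Function.Surjective (0 : M →ₗ[R] PUnit.{u + 1}) := fun _ => ⟨0, rfl⟩
  have hfg : Function.Exact (LinearMap.id : M →ₗ[R] M) (0 : M →ₗ[R] PUnit.{u + 1}) :=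
    fun x => ⟨fun _ => ⟨x, rfl⟩, fun _ => rfl⟩
  match i with
  | 0 => exact (zeroEquivGamma a M).toEquiv.subsingleton
  | 1 =>
    obtain ⟨φ, hφ, -⟩ := exists_gamma_surjection_one a hf hfg hg
    exact hφ.subsingleton
  | i + 2 =>
    obtain ⟨e⟩ := nonempty_shift_equiv a hf hfg hg i
    have := ih (i + 1) (Nat.lt_succ_self _) PUnit.{u + 1}
    exact e.toEquiv.subsingleton

variable [IsNoetherianRing R]

lemma nonempty_atPrime_equiv (a : Ideal R) (i : ℕ) (M : Type u) [AddCommGroup M] [Module R M]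
    (p : PrimeSpectrum R) : Nonempty (LocalizedModule p.asIdeal.primeCompl (H a i M) ≃ₗ[
      Localization.AtPrime p.asIdeal] H (locIdeal p a) i (locModule p M)) :=
  nonempty_localized_equiv p.asIdeal.primeCompl a i M

lemma support_H_subset (a : Ideal R) (i : ℕ) (M : Type u) [AddCommGroup M] [Module R M] :
    Module.support R (H a i M) ⊆ Module.support R M := by
  intro p hp
  by_contra hpM
  have : Subsingleton (locModule p M) := Module.notMem_support_iff.1 hpM
  obtain ⟨e⟩ := nonempty_atPrime_equiv a i M p
  have := subsingleton_H_of_subsingleton (locIdeal p a) i (locModule p M)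
  exact Module.notMem_support_iff.2 e.toEquiv.subsingleton hp

lemma notMem_support_pow_smul_of_finite {a : Ideal R} {L : Type u} [AddCommGroup L] [Module R L]
    (htor : ∀ z : L, z ∈ gamma a L) (p : PrimeSpectrum R)
    [hfin : Module.Finite (Localization.AtPrime p.asIdeal)
      (LocalizedModule p.asIdeal.primeCompl L)] :
    ∃ t : ℕ, p ∉ Module.support R ↥(a ^ t • (⊤ : Submodule R L)) := by
  obtain ⟨t, ht⟩ := exists_pow_smul_eq_zero_of_fg
    (⊤ : Submodule (Localization.AtPrime p.asIdeal) (LocalizedModule p.asIdeal.primeCompl L))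
    hfin.fg_top (fun z _ => mem_gamma_localized p.asIdeal.primeCompl htor z)
  refine ⟨t, fun hp => ?_⟩
  obtain ⟨x, hx, z, hz⟩ := (mem_support_smul_top_iff _).1 hp
  have h₀ := ht (algebraMap R _ x) (by rw [← Ideal.map_pow]; exact Ideal.mem_map_of_mem _ hx)
    (LocalizedModule.mk z 1) trivial
  rw [algebraMap_smul, smul_mk_eq_zero_iff] at h₀
  obtain ⟨u, hu, h⟩ := h₀
  exact hz u hu h

omit [IsNoetherianRing R] in
lemma notMem_support_of_not_le {a : Ideal R} {L : Type u} [AddCommGroup L] [Module R L]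
    (htor : ∀ z : L, z ∈ gamma a L) (p : PrimeSpectrum R) (hp : ¬ a ≤ p.asIdeal) :
    p ∉ Module.support R L := by
  obtain ⟨x, hx, hxp⟩ := SetLike.not_le_iff_exists.1 hp
  refine Module.notMem_support_iff'.2 fun z => ?_
  obtain ⟨t, ht⟩ := htor z
  exact ⟨x ^ t, fun h => hxp (p.isPrime.mem_of_pow_mem t h), ht _ (Ideal.pow_mem_pow hx t)⟩

/-- Over `Supp(M ⧸ a M)` the localized module is finitely generated and torsion, hence killed by a
power of `a`. Outside it `H^i_a(M)` already vanishes at `p`, so `t = 0` does. -/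
lemma exists_notMem_support_pow_smul {a : Ideal R} {M : Type u} [AddCommGroup M] [Module R M]
    [Module.Finite R M] {n i : ℕ} (hi : (i : ℕ∞) < nthFinitenessDim n a M) (p : PrimeSpectrum R)
    (hp : (n : WithBot ℕ∞) ≤ ringKrullDim (R ⧸ p.asIdeal)) :
    ∃ t : ℕ, p ∉ Module.support R ↥(a ^ t • (⊤ : Submodule R (H a i M))) := by
  have htor := mem_gamma_localCohomology a i M
  by_cases hpM : p ∈ Module.support R (M ⧸ (a • (⊤ : Submodule R M)))
  · have h₁ : (i : ℕ∞) < finitenessDim (locIdeal p a) (locModule p M) :=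
      hi.trans_le (iInf₂_le p ⟨hpM, hp⟩)
    have h₂ : Module.Finite _ (H (locIdeal p a) i (locModule p M)) :=
      not_not.1 ((lt_iInf_natCast_iff.1 h₁).2 i le_rfl)
    obtain ⟨e⟩ := nonempty_atPrime_equiv a i M p
    have := Module.Finite.equiv e.symm
    exact notMem_support_pow_smul_of_finite htor p
  · refine ⟨0, fun h => hpM ?_⟩
    have h' : p ∈ Module.support R (H a i M) :=
      Module.support_subset_of_injective _ (Submodule.subtype_injective _) h
    rw [Module.support_quotient]
    refine ⟨support_H_subset a i M h', ?_⟩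
    by_contra hap
    exact notMem_support_of_not_le htor p hap h'

omit [IsNoetherianRing R] in
-- Supports are stable under specialization, so only the first prime of a chain has to be tested.
lemma le_supportDim_iff {L : Type*} [AddCommGroup L] [Module R L] {n : ℕ} :
    (n : WithBot ℕ∞) ≤ Module.supportDim R L ↔
      ∃ s : LTSeries (PrimeSpectrum R), s.length = n ∧ s.head ∈ Module.support R L := by
  rw [Module.supportDim, Order.le_krullDim_iff]
  constructor
  · rintro ⟨s, hs⟩
    exact ⟨s.map Subtype.val (fun _ _ h => h), hs, s.head.2⟩
  · rintro ⟨s, hs, h⟩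
    exact ⟨⟨s.length, fun i => ⟨s i, Module.mem_support_mono (s.monotone (Fin.zero_le i)) h⟩,
      fun i => s.step i⟩, hs⟩

omit [IsNoetherianRing R] in
lemma le_ringKrullDim_quotient {p : PrimeSpectrum R} {n : ℕ} (s : LTSeries (PrimeSpectrum R))
    (hs : s.length = n) (hp : p ≤ s.head) :
    (n : WithBot ℕ∞) ≤ ringKrullDim (R ⧸ p.asIdeal) := by
  rw [← Module.supportDim_quotient_eq_ringKrullDim, le_supportDim_iff]
  refine ⟨s, hs, ?_⟩
  rw [Module.support_eq_zeroLocus, Ideal.annihilator_quotient]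
  exact hp

omit [IsNoetherianRing R] in
-- Otherwise `q < q'` extends to a chain of length two above `p`.
lemma isMaximal_of_lt {p q q' : PrimeSpectrum R} (hp : p ≤ q) (hq : q < q')
    (h : ¬ (2 : WithBot ℕ∞) ≤ ringKrullDim (R ⧸ p.asIdeal)) : q'.asIdeal.IsMaximal := by
  by_contra hmax
  obtain ⟨m, hm, hle⟩ := Ideal.exists_le_maximal q'.asIdeal q'.isPrime.ne_top
  have hlt : q' < ⟨m, hm.isPrime⟩ := lt_of_le_of_ne hle fun h => hmax (h ▸ hm)
  let s : LTSeries (PrimeSpectrum R) := ⟨2, ![q, q', ⟨m, hm.isPrime⟩], fun i => by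
    fin_cases i
    · exact hq
    · exact hlt⟩
  exact h (le_ringKrullDim_quotient (n := 2) s rfl hp)

variable {a : Ideal R} {M : Type u} [AddCommGroup M] [Module R M] [Module.Finite R M]

/-- The local cohomology modules `H^i_a(M)` with `i < f^2_a(M)` are cofinite. -/
theorem finite_extQuot_localCohomology (i : ℕ) (hi : (i : ℕ∞) < nthFinitenessDim 2 a M) (k : ℕ) :
    Module.Finite R (extQuot a k (H a i M)) := by
  induction i using Nat.strong_induction_on generalizing k with
  | _ i ih =>
  cases i with
  | zero =>
    have : Module.Finite R (H a 0 M) := Module.Finite.equiv (zeroEquivGamma a M).symm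
    infer_instance
  | succ i =>
    have hP := isExactClosed_finite (R := R)
    have hext := hP.ext_localCohomology_succ (a := a) i M
      (fun k => show Module.Finite R (extQuot a (k + 2) (gamma a M)) by infer_instance)
      (fun j hj k => ih (j + 1) (Nat.succ_lt_succ hj)
        (lt_trans (by exact_mod_cast Nat.succ_lt_succ hj) hi) k)
    have h₀ : Module.Finite R (extQuot a 0 (H a (i + 1) M)) := hext.1
      (show Module.Finite R (extQuot a (i + 1) M) by infer_instance)
    have h₁ : Module.Finite R (extQuot a 1 (H a (i + 1) M)) := hext.2
      (show Module.Finite R (extQuot a (i + 2) M) by infer_instance)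
    have htor := mem_gamma_localCohomology a (i + 1) M
    have hfin := finite_extQuot_zero_iff.1 h₀
    have hAss := finite_associatedPrimes htor
    -- At primes of dimension less than two the value of `t` is arbitrary; including it in the
    -- supremum only enlarges the exponent.
    choose! t ht using exists_notMem_support_pow_smul (n := 2) hi
    let t₀ := hAss.toFinset.sup t
    let W := Submodule.torsionBySet R (H a (i + 1) M) ((a ^ t₀ : Ideal R) : Set R)
    have hW : Module.Finite R W := finite_torsionBySet_pow t₀
    have hWsurj := Submodule.mkQ_surjective W
    have hWexact : Function.Exact W.subtype W.mkQ := LinearMap.exact_iff.2 (by simp)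
    refine hP.ext_middle (Submodule.subtype_injective W) hWexact hWsurj k
      (show Module.Finite R (extQuot a k W) by infer_instance) ?_
    refine finite_extQuot_of_support (mem_gamma_of_surjective hWsurj htor) (fun p hp q hpq => ?_)
      (hP.ext_right (Submodule.subtype_injective W) hWexact hWsurj 0 h₀
        (show Module.Finite R (extQuot a 1 W) by infer_instance))
      (hP.ext_right (Submodule.subtype_injective W) hWexact hWsurj 1 h₁
        (show Module.Finite R (extQuot a 2 W) by infer_instance)) k
    -- An associated prime of `a ^ t₀ H` is one of `H`; if its dimension were at least two, the
    -- choice of `t₀` would exclude it from the support. So the primes of the support of `H ⧸ W`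
    -- have dimension at most one.
    obtain ⟨q', hqW, hle⟩ := exists_isAssociatedPrime_le (mem_support_of_mem_support_quotient _ hp)
    refine isMaximal_of_lt hle hpq fun hdim => ht q' hdim ?_
    have hqH : IsAssociatedPrime q'.asIdeal (H a (i + 1) M) :=
      IsAssociatedPrime.map_of_injective (Submodule.subtype _) hqW (Submodule.subtype_injective _)
    have hle' : t q' ≤ t₀ := Finset.le_sup (f := t) (hAss.mem_toFinset.2 hqH)
    have hsub : a ^ t₀ • (⊤ : Submodule R (H a (i + 1) M)) ≤ a ^ t q' • ⊤ :=
      Submodule.smul_mono_left (Ideal.pow_le_pow_right hle')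
    exact Module.support_subset_of_injective (Submodule.inclusion hsub)
      (Submodule.inclusion_injective hsub) (IsAssociatedPrime.mem_support hqW)

/-- For `i ≤ f^2_a(M)` the module `H^i_a(M)` has only finitely many associated primes. -/
theorem finite_associatedPrimes_localCohomology (i : ℕ)
    (hi : (i : ℕ∞) ≤ nthFinitenessDim 2 a M) :
    {p : PrimeSpectrum R | IsAssociatedPrime p.asIdeal (H a i M)}.Finite := by
  have : Module.Finite R (extQuot a 0 (H a i M)) := by
    cases i with
    | zero =>
      have : Module.Finite R (H a 0 M) := Module.Finite.equiv (zeroEquivGamma a M).symm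
      infer_instance
    | succ i =>
      refine ((isExactClosed_finite (R := R)).ext_localCohomology_succ (a := a) i M
        (fun k => show Module.Finite R (extQuot a (k + 2) (gamma a M)) by infer_instance)
        (fun j hj k => finite_extQuot_localCohomology (j + 1)
          (lt_of_lt_of_le (by exact_mod_cast Nat.succ_lt_succ hj) hi) k)).1 ?_
      change Module.Finite R (extQuot a (i + 1) M)
      infer_instance
  have := finite_extQuot_zero_iff.1 this
  exact finite_associatedPrimes (mem_gamma_localCohomology a i M)

lemma one_le_finitenessDim : 1 ≤ finitenessDim a M := by
  refine le_iInf_natCast_iff.2 fun i hi => ?_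
  obtain rfl : i = 0 := by
    have : i < 1 := by exact_mod_cast hi
    omega
  exact not_not.2 (Module.Finite.equiv (zeroEquivGamma a M).symm)

omit [Module.Finite R M] in
lemma finitenessDim_le_nthFinitenessDim (n : ℕ) : finitenessDim a M ≤ nthFinitenessDim n a M := by
  refine le_iInf₂ fun p _ => le_iInf_natCast_iff.2 fun i hi => not_not.2 ?_
  have : Module.Finite R (H a i M) := not_not.1 ((lt_iInf_natCast_iff.1 hi).2 i le_rfl)
  obtain ⟨e⟩ := nonempty_atPrime_equiv a i M p
  have : Module.Finite (Localization.AtPrime p.asIdeal)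
      (LocalizedModule p.asIdeal.primeCompl (H a i M)) :=
    Module.Finite.of_isLocalizedModule p.asIdeal.primeCompl
      (Rₚ := Localization.AtPrime p.asIdeal) (LocalizedModule.mkLinearMap _ (H a i M))
  exact Module.Finite.equiv e

omit [IsNoetherianRing R] [Module.Finite R M] in
lemma nthFinitenessDim_mono {m n : ℕ} (h : m ≤ n) :
    nthFinitenessDim m a M ≤ nthFinitenessDim n a M :=
  le_iInf₂ fun p hp => iInf₂_le p ⟨hp.1, le_trans (by exact_mod_cast h) hp.2⟩

omit [IsNoetherianRing R] in
lemma subsingleton_of_torsionBySet_eq_bot {a : Ideal R} {L : Type*} [AddCommGroup L] [Module R L]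
    (htor : ∀ z : L, z ∈ gamma a L) (h : ∀ z : L, (∀ x ∈ a, x • z = 0) → z = 0) :
    Subsingleton L := by
  have key : ∀ t : ℕ, ∀ z : L, (∀ x ∈ a ^ t, x • z = 0) → z = 0 := by
    intro t
    induction t with
    | zero => exact fun z hz => by simpa using hz 1 (by simp)
    | succ t ih =>
      intro z hz
      refine h z fun x hx => ih _ fun y hy => ?_
      rw [smul_smul]
      exact hz _ (pow_succ a t ▸ Ideal.mul_mem_mul hy hx)
  have h0 : ∀ z : L, z = 0 := fun z => by
    obtain ⟨t, ht⟩ := htor z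
    exact key t z ht
  exact ⟨fun x y => (h0 x).trans (h0 y).symm⟩

omit [IsNoetherianRing R] in
lemma subsingleton_of_extQuot_zero {a : Ideal R} {L : Type u} [AddCommGroup L] [Module R L]
    (htor : ∀ z : L, z ∈ gamma a L) (h : Subsingleton (extQuot a 0 L)) : Subsingleton L := by
  have h' : Subsingleton (Submodule.torsionBySet R L (a : Set R)) :=
    (extQuotZeroEquiv a L).symm.toEquiv.subsingleton
  refine subsingleton_of_torsionBySet_eq_bot htor fun z hz => ?_
  exact congrArg Subtype.val (Subsingleton.elim
    (⟨z, (Submodule.mem_torsionBySet_iff _ _).2 fun x => hz x x.2⟩ :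
      Submodule.torsionBySet R L (a : Set R)) 0)

/-- `Ext^i(R ⧸ a, M)` vanishes below the length of the regular sequence. Applied to the class of
zero modules, `ext_localCohomology_succ` gives `Hom(R ⧸ a, H^i_a(M)) = 0`, and a torsion module with
this property is zero. -/
lemma subsingleton_localCohomology (ha : a • (⊤ : Submodule R M) ≠ ⊤) {rs : List R}
    (hrs : ∀ x ∈ rs, x ∈ a) (hreg : RingTheory.Sequence.IsRegular M rs) (i : ℕ)
    (hi : i < rs.length) : Subsingleton (H a i M) := by
  have hext : ∀ i < rs.length, Subsingleton (extQuot a i M) :=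
    ModuleCat.subsingleton_ext_of_exists_isRegular a (ModuleCat.of R (R ⧸ a))
      ((Module.support_eq_zeroLocus (R := R) (M := R ⧸ a)).trans
        (by rw [Ideal.annihilator_quotient])).subset
      (ModuleCat.of R M) (lt_top_iff_ne_top.2 ha) rs hrs hreg
  have hP := isExactClosed_subsingleton (R := R)
  have hgamma : Subsingleton (gamma a M) ∨ rs.length = 0 := by
    by_cases h : rs.length = 0
    · exact Or.inr h
    · refine Or.inl (subsingleton_of_extQuot_zero (a := a) (fun z => ?_)
        (hP.ext_zero_of_injective (gamma a M).subtype_injective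
          (hext 0 (Nat.pos_of_ne_zero h))))
      obtain ⟨t, ht⟩ := z.2
      exact ⟨t, fun x hx => Subtype.ext (ht x hx)⟩
  have hgamma := hgamma.resolve_right (by omega)
  induction i using Nat.strong_induction_on with
  | _ i ih =>
  cases i with
  | zero => exact (zeroEquivGamma a M).toEquiv.subsingleton
  | succ i =>
    refine subsingleton_of_extQuot_zero (mem_gamma_localCohomology a (i + 1) M)
      ((hP.ext_localCohomology_succ i M (fun k => hP.ext_of_subsingleton _) fun j hj k => ?_).1
        (hext _ hi))
    have := ih (j + 1) (Nat.succ_lt_succ hj) (by omega)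
    exact hP.ext_of_subsingleton k

lemma gradeOn_le_finitenessDim (ha : a • (⊤ : Submodule R M) ≠ ⊤) :
    gradeOn a M ≤ finitenessDim a M := by
  refine iSup₂_le fun rs hrs => le_iInf_natCast_iff.2 fun i hi => not_not.2 ?_
  have := subsingleton_localCohomology ha hrs.1 hrs.2 i (by exact_mod_cast hi)
  infer_instance

end LocalCohomology

/-! ### Dimension of supports and the local-global principle. -/

section InDimension

lemma supportDim_mono {L L' : Type*} [AddCommGroup L] [Module R L] [AddCommGroup L'] [Module R L']
    (h : Module.support R L ⊆ Module.support R L') :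
    Module.supportDim R L ≤ Module.supportDim R L' :=
  Order.krullDim_le_of_strictMono (fun p => ⟨p.1, h p.2⟩) fun _ _ h => h

/-- For torsion modules `L` the finitely generated submodule in the definition of being in
dimension `< n` is killed by a power of `b`. -/
lemma exists_inDimensionLT_iff {a b : Ideal R} (hba : b ≤ a) {L : Type u} [AddCommGroup L]
    [Module R L] (htor : ∀ z : L, z ∈ gamma a L) {n : ℕ} :
    (∃ t : ℕ, InDimensionLT R ↥(b ^ t • (⊤ : Submodule R L)) n) ↔
      ∃ t : ℕ, Module.supportDim R ↥(b ^ t • (⊤ : Submodule R L)) < (n : WithBot ℕ∞) := by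
  constructor
  · rintro ⟨t, N, hN, hdim⟩
    obtain ⟨s, hs⟩ := exists_pow_smul_eq_zero_of_fg (a := a) N hN fun z _ =>
      mem_gamma_of_injective (Submodule.subtype_injective _) htor z
    -- If `r z ∈ N` for `z ∈ b ^ t L` and `x ∈ b ^ s`, then `r x z = 0`; so `b ^ (s + t) L` vanishes
    -- wherever `b ^ t L ⧸ N` does.
    refine ⟨s + t, lt_of_le_of_lt (supportDim_mono fun p hp => ?_) hdim⟩
    by_contra hpN
    rw [pow_add, ← smul_eq_mul, Submodule.smul_assoc] at hp
    refine notMem_support_smul (fun x hx z hz => ?_) hp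
    obtain ⟨r, hr, h⟩ := Module.notMem_support_iff'.1 hpN (Submodule.Quotient.mk ⟨z, hz⟩)
    rw [← Submodule.Quotient.mk_smul, Submodule.Quotient.mk_eq_zero] at h
    refine ⟨r, hr, ?_⟩
    rw [smul_comm]
    exact congrArg Subtype.val (hs x (Ideal.pow_right_mono hba s hx) _ h)
  · rintro ⟨t, ht⟩
    refine ⟨t, ⊥, Submodule.fg_bot, ?_⟩
    rwa [Module.supportDim_eq_of_equiv (Submodule.quotEquivOfEqBot _ rfl)]

lemma exists_supportDim_lt_iff {b : Ideal R} {L : Type*} [AddCommGroup L] [Module R L] {n : ℕ} :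
    (∃ t : ℕ, Module.supportDim R ↥(b ^ t • (⊤ : Submodule R L)) < (n : WithBot ℕ∞)) ↔
      ∃ t : ℕ, ∀ s : LTSeries (PrimeSpectrum R), s.length = n →
        s.head ∉ Module.support R ↥(b ^ t • (⊤ : Submodule R L)) := by
  refine exists_congr fun t => ?_
  rw [← not_le, le_supportDim_iff]
  push Not
  rfl

lemma support_smul_top_subset {L L' : Type*} [AddCommGroup L] [Module R L] [AddCommGroup L']
    [Module R L'] (e : L ≃ₗ[R] L') (c : Ideal R) :
    Module.support R ↥(c • (⊤ : Submodule R L)) ⊆ Module.support R ↥(c • (⊤ : Submodule R L')) := by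
  intro p hp
  obtain ⟨x, hx, z, hz⟩ := (mem_support_smul_top_iff c).1 hp
  refine (mem_support_smul_top_iff c).2 ⟨x, hx, e z, fun r hr h => hz r hr (e.injective ?_)⟩
  rw [map_smul, map_smul, h, map_zero]

lemma supportDim_smul_top_congr {L L' : Type*} [AddCommGroup L] [Module R L] [AddCommGroup L']
    [Module R L'] (e : L ≃ₗ[R] L') (c : Ideal R) :
    Module.supportDim R ↥(c • (⊤ : Submodule R L)) =
      Module.supportDim R ↥(c • (⊤ : Submodule R L')) :=
  (supportDim_mono (support_smul_top_subset e c)).antisymm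
    (supportDim_mono (support_smul_top_subset e.symm c))

lemma support_pow_smul_anti {b : Ideal R} {L : Type*} [AddCommGroup L] [Module R L] {s t : ℕ}
    (h : s ≤ t) : Module.support R ↥(b ^ t • (⊤ : Submodule R L)) ⊆
      Module.support R ↥(b ^ s • (⊤ : Submodule R L)) := by
  have hle : b ^ t • (⊤ : Submodule R L) ≤ b ^ s • ⊤ :=
    Submodule.smul_mono_left (Ideal.pow_le_pow_right h)
  exact Module.support_subset_of_injective (Submodule.inclusion hle)
    (Submodule.inclusion_injective hle)

lemma mem_support_smul_top_localized_iff {L : Type u} [AddCommGroup L] [Module R L]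
    (S : Submonoid R) (c : Ideal R) (Q : PrimeSpectrum (Localization S)) :
    Q ∈ Module.support (Localization S)
        ↥(c.map (algebraMap R (Localization S)) •
          (⊤ : Submodule (Localization S) (LocalizedModule S L))) ↔
      PrimeSpectrum.comap (algebraMap R (Localization S)) Q ∈
        Module.support R ↥(c • (⊤ : Submodule R L)) := by
  have hS : ∀ u ∈ S, algebraMap R (Localization S) u ∉ Q.asIdeal := fun u hu h =>
    Q.isPrime.ne_top (Ideal.eq_top_of_isUnit_mem _ h (IsLocalization.map_units _ (⟨u, hu⟩ : S)))
  constructor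
  · intro hQ
    by_contra hcon
    rw [mem_support_smul_top_iff] at hcon
    push Not at hcon
    refine notMem_support_smul (fun x hx z _ => ?_) hQ
    obtain ⟨⟨y, s⟩, hys⟩ := (IsLocalization.mem_map_algebraMap_iff S _).1 hx
    induction z with | _ z s'
    obtain ⟨r, hr, h⟩ := hcon y y.2 z
    refine ⟨algebraMap R _ r * algebraMap R _ s, Q.isPrime.mul_notMem hr (hS s s.2), ?_⟩
    rw [smul_smul, mul_assoc, mul_comm (algebraMap R _ (s : R)), hys, mul_smul, algebraMap_smul,
      algebraMap_smul, LocalizedModule.smul'_mk, LocalizedModule.smul'_mk, h,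
      LocalizedModule.zero_mk]
  · intro hQ
    obtain ⟨x, hx, z, hz⟩ := (mem_support_smul_top_iff c).1 hQ
    refine (mem_support_smul_top_iff _).2 ⟨algebraMap R _ x, Ideal.mem_map_of_mem _ hx,
      LocalizedModule.mk z 1, fun r hr h => ?_⟩
    obtain ⟨⟨y, s⟩, hys⟩ := IsLocalization.surj S r
    have h' : y • x • LocalizedModule.mk z (1 : S) = 0 := by
      rw [← algebraMap_smul (Localization S) y, ← algebraMap_smul (Localization S) x, ← hys,
        mul_comm, mul_smul, h, smul_zero]
    rw [smul_smul, smul_mk_eq_zero_iff] at h'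
    obtain ⟨u, hu, h'⟩ := h'
    refine hz (u * y) (fun hmem => ?_) (by rw [mul_smul, ← h', mul_smul])
    have hmem' : algebraMap R (Localization S) (u * y) ∈ Q.asIdeal := hmem
    rw [map_mul, ← hys] at hmem'
    exact Q.isPrime.mul_notMem (hS u hu) (Q.isPrime.mul_notMem hr (hS s s.2)) hmem'

lemma mem_support_pow_smul_local_iff {L : Type u} [AddCommGroup L] [Module R L] (b : Ideal R)
    (t : ℕ) (p : PrimeSpectrum R) (Q : PrimeSpectrum (Localization.AtPrime p.asIdeal)) :
    Q ∈ Module.support (Localization.AtPrime p.asIdeal) ↥(locIdeal p b ^ t •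
        (⊤ : Submodule (Localization.AtPrime p.asIdeal) (locModule p L))) ↔
      PrimeSpectrum.comap (algebraMap R (Localization.AtPrime p.asIdeal)) Q ∈
        Module.support R ↥(b ^ t • (⊤ : Submodule R L)) := by
  rw [← mem_support_smul_top_localized_iff p.asIdeal.primeCompl (b ^ t) Q, Ideal.map_pow]

/-- The primes of a chain all lie below its last one, and these are the primes of the localization
there. -/
lemma exists_series_atPrime (s : LTSeries (PrimeSpectrum R)) :
    ∃ s' : LTSeries (PrimeSpectrum (Localization.AtPrime s.last.asIdeal)),
      s'.length = s.length ∧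
      PrimeSpectrum.comap (algebraMap R (Localization.AtPrime s.last.asIdeal)) s'.head = s.head := by
  let e : PrimeSpectrum (Localization.AtPrime s.last.asIdeal) ≃o Set.Iic s.last :=
    IsLocalization.AtPrime.primeSpectrumOrderIso
      (Localization.AtPrime s.last.asIdeal) s.last.asIdeal
  let s₁ : LTSeries (Set.Iic s.last) :=
    ⟨s.length, fun i => ⟨s i, s.monotone (Fin.le_last i)⟩, fun i => s.step i⟩
  exact ⟨s₁.map e.symm e.symm.strictMono, rfl, congrArg Subtype.val (e.apply_symm_apply s₁.head)⟩

lemma exists_series_of_atPrime {p : PrimeSpectrum R}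
    (s : LTSeries (PrimeSpectrum (Localization.AtPrime p.asIdeal))) :
    ∃ s' : LTSeries (PrimeSpectrum R), s'.length = s.length ∧ s'.head =
      PrimeSpectrum.comap (algebraMap R (Localization.AtPrime p.asIdeal)) s.head := by
  let e : PrimeSpectrum (Localization.AtPrime p.asIdeal) ≃o Set.Iic p :=
    IsLocalization.AtPrime.primeSpectrumOrderIso (Localization.AtPrime p.asIdeal) p.asIdeal
  exact ⟨(s.map e e.strictMono).map Subtype.val fun _ _ h => h, rfl, rfl⟩

/-- Local-global principle for a module with finitely many associated primes. -/
theorem exists_supportDim_lt_local_iff [IsNoetherianRing R] {b : Ideal R} {L : Type u}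
    [AddCommGroup L] [Module R L]
    (hAss : {p : PrimeSpectrum R | IsAssociatedPrime p.asIdeal L}.Finite) {n : ℕ} :
    (∀ p : PrimeSpectrum R, ∃ t : ℕ, Module.supportDim (Localization.AtPrime p.asIdeal)
        ↥(locIdeal p b ^ t • (⊤ : Submodule (Localization.AtPrime p.asIdeal) (locModule p L))) <
          (n : WithBot ℕ∞)) ↔
      ∃ t : ℕ, Module.supportDim R ↥(b ^ t • (⊤ : Submodule R L)) < (n : WithBot ℕ∞) := by
  constructor
  · intro h
    have key : ∀ q : PrimeSpectrum R, (∃ s : LTSeries (PrimeSpectrum R), s.length = n ∧ q ≤ s.head) →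
        ∃ t : ℕ, q ∉ Module.support R ↥(b ^ t • (⊤ : Submodule R L)) := by
      rintro q ⟨s, hs, hqs⟩
      -- The local hypothesis is used at the top of the chain, where the whole chain is still
      -- visible.
      obtain ⟨t, ht⟩ := exists_supportDim_lt_iff.1 (h s.last)
      obtain ⟨s', hs', hhead⟩ := exists_series_atPrime s
      refine ⟨t, fun hmem => ht s' (hs'.trans hs) ?_⟩
      rw [mem_support_pow_smul_local_iff, hhead]
      exact Module.mem_support_mono hqs hmem
    choose! t ht using key
    -- The supremum over the associated primes of `L` suffices, as they include those of every `b ^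
    -- t L`.
    refine exists_supportDim_lt_iff.2 ⟨hAss.toFinset.sup t, fun s hs hmem => ?_⟩
    obtain ⟨q, hq, hle⟩ := exists_isAssociatedPrime_le hmem
    have hqL := IsAssociatedPrime.map_of_injective (Submodule.subtype _) hq
      (Submodule.subtype_injective _)
    exact ht q ⟨s, hs, hle⟩ (support_pow_smul_anti
      (Finset.le_sup (f := t) (hAss.mem_toFinset.2 hqL)) (IsAssociatedPrime.mem_support hq))
  · intro h p
    obtain ⟨t, ht⟩ := exists_supportDim_lt_iff.1 h
    refine exists_supportDim_lt_iff.2 ⟨t, fun s hs hmem => ?_⟩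
    obtain ⟨s', hs', hhead⟩ := exists_series_of_atPrime s
    refine ht s' (hs'.trans hs) ?_
    rw [hhead]
    exact (mem_support_pow_smul_local_iff b t p _).1 hmem

variable [IsNoetherianRing R]

omit [IsNoetherianRing R] in
lemma lt_hDim_iff {a b : Ideal R} (hba : b ≤ a) {M : Type u} [AddCommGroup M] [Module R M] {n : ℕ}
    {r : ℕ∞} : r < hDim a b M n ↔ r ≠ ⊤ ∧ ∀ i : ℕ, (i : ℕ∞) ≤ r → ∃ t : ℕ,
      Module.supportDim R ↥(b ^ t • (⊤ : Submodule R (H a i M))) < (n : WithBot ℕ∞) := by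
  rw [hDim, lt_iInf_natCast_iff]
  refine and_congr_right fun _ => forall₂_congr fun i _ => ?_
  rw [← exists_inDimensionLT_iff hba (mem_gamma_localCohomology a i M)]
  push Not
  rfl

/-- The local-global principle for `h_a^b(M)^n` up to `f^2_a(M)`. -/
theorem lt_hDim_local_iff [Nontrivial R] {a b : Ideal R} (hba : b ≤ a) {M : Type u}
    [AddCommGroup M] [Module R M] [Module.Finite R M] {n : ℕ} {r : ℕ∞}
    (hr : r ≤ nthFinitenessDim 2 a M) :
    (∀ p : PrimeSpectrum R, r < hDim (locIdeal p a) (locIdeal p b) (locModule p M) n) ↔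
      r < hDim a b M n := by
  have hloc : ∀ (p : PrimeSpectrum R) (i t : ℕ), Module.supportDim (Localization.AtPrime p.asIdeal)
        ↥(locIdeal p b ^ t • (⊤ : Submodule (Localization.AtPrime p.asIdeal)
          (H (locIdeal p a) i (locModule p M)))) =
      Module.supportDim (Localization.AtPrime p.asIdeal) ↥(locIdeal p b ^ t •
        (⊤ : Submodule (Localization.AtPrime p.asIdeal) (locModule p (H a i M)))) := by
    intro p i t
    obtain ⟨e⟩ := nonempty_atPrime_equiv a i M p
    exact (supportDim_smul_top_congr e _).symm
  simp only [lt_hDim_iff hba, fun p : PrimeSpectrum R => lt_hDim_iff (n := n) (r := r)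
    (M := locModule p M) (Ideal.map_mono hba : locIdeal p b ≤ locIdeal p a), hloc]
  constructor
  · intro h
    -- The condition `r ≠ ⊤` must be read off at some prime, so the spectrum has to be nonempty.
    obtain ⟨p₀⟩ := (inferInstance : Nonempty (PrimeSpectrum R))
    refine ⟨(h p₀).1, fun i hi => (exists_supportDim_lt_local_iff
      (finite_associatedPrimes_localCohomology i (hi.trans hr))).1 fun p => (h p).2 i hi⟩
  · intro h p
    exact ⟨h.1, fun i hi => (exists_supportDim_lt_local_iff
      (finite_associatedPrimes_localCohomology i (hi.trans hr))).2 (h.2 i hi) p⟩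

/-- The `b`-finiteness dimension is the case `n = 0` of `h_a^b(M)^n`. -/
lemma bFinitenessDim_eq_hDim_zero {a b : Ideal R} (hba : b ≤ a) (M : Type u) [AddCommGroup M]
    [Module R M] : bFinitenessDim a b M = hDim a b M 0 := by
  have key : ∀ i : ℕ, b ≤ (Module.annihilator R (H a i M)).radical ↔
      ∃ t : ℕ, InDimensionLT R ↥(b ^ t • (⊤ : Submodule R (H a i M))) 0 := by
    intro i
    rw [exists_inDimensionLT_iff hba (mem_gamma_localCohomology a i M)]
    -- A support of dimension less than `0` is empty, so the condition says `b ^ t H^i_a(M) = 0`.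
    have hsub : ∀ t : ℕ, Module.supportDim R ↥(b ^ t • (⊤ : Submodule R (H a i M))) <
        ((0 : ℕ) : WithBot ℕ∞) ↔ b ^ t ≤ Module.annihilator R (H a i M) := by
      intro t
      have h₁ : Module.supportDim R ↥(b ^ t • (⊤ : Submodule R (H a i M))) <
          ((0 : ℕ) : WithBot ℕ∞) ↔ Subsingleton ↥(b ^ t • (⊤ : Submodule R (H a i M))) := by
        rw [← Module.supportDim_eq_bot_iff_subsingleton (R := R)]
        exact WithBot.lt_zero_iff_eq_bot _
      rw [h₁, Submodule.subsingleton_iff_eq_bot, eq_bot_iff, Submodule.smul_le]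
      constructor
      · intro h x hx
        exact Module.mem_annihilator.2 fun z => (Submodule.mem_bot R).1 (h x hx z trivial)
      · intro h x hx z _
        exact (Submodule.mem_bot R).2 (Module.mem_annihilator.1 (h hx) z)
    simp only [hsub]
    exact ⟨fun h => Ideal.exists_pow_le_of_le_radical_of_fg h (IsNoetherian.noetherian b),
      fun ⟨t, ht⟩ x hx => ⟨t, ht (Ideal.pow_mem_pow hx t)⟩⟩
  simp only [bFinitenessDim, hDim, key, not_exists]

end InDimension

end LocalGlobal

theorem corollary1p2 {R : Type u} [CommRing R] [IsNoetherianRing R] [Nontrivial R]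
    (M : Type u) [AddCommGroup M] [Module R M] [Module.Finite R M]
    (a b : Ideal R) (hba : b ≤ a) :
    (∀ n : ℕ, ∀ r ∈ ({1, finitenessDim a M, nthFinitenessDim 1 a M,
        nthFinitenessDim 2 a M} : Set ℕ∞),
      ((∀ p : PrimeSpectrum R, r < hDim (locIdeal p a) (locIdeal p b) (locModule p M) n) ↔
        r < hDim a b M n)) ∧
    (a • (⊤ : Submodule R M) ≠ ⊤ →
      (∀ n : ℕ,
        ((∀ p : PrimeSpectrum R,
            gradeOn a M < hDim (locIdeal p a) (locIdeal p b) (locModule p M) n) ↔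
          gradeOn a M < hDim a b M n)) ∧
      ((∀ p : PrimeSpectrum R,
          gradeOn a M < bFinitenessDim (locIdeal p a) (locIdeal p b) (locModule p M)) ↔
        gradeOn a M < bFinitenessDim a b M)) := by
  have h₂ : finitenessDim a M ≤ nthFinitenessDim 2 a M := finitenessDim_le_nthFinitenessDim 2
  refine ⟨fun n r hr => lt_hDim_local_iff hba ?_, fun ha => ?_⟩
  · rcases hr with rfl | rfl | rfl | rfl
    · exact one_le_finitenessDim.trans h₂
    · exact h₂
    · exact nthFinitenessDim_mono one_le_two
    · exact le_rfl
  · have hgrade := (gradeOn_le_finitenessDim ha).trans h₂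
    refine ⟨fun n => lt_hDim_local_iff hba hgrade, ?_⟩
    simp only [bFinitenessDim_eq_hDim_zero hba, fun p : PrimeSpectrum R =>
      bFinitenessDim_eq_hDim_zero (Ideal.map_mono hba : locIdeal p b ≤ locIdeal p a)
        (locModule p M)]
    exact lt_hDim_local_iff hba hgrade
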